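/- **Setting.** Let $T\in(0,\infty)$, $\tau\in(0,T)$, $\tau_1\in(\tau,T)$, $\tau_2\in(\tau_1,T)$, $\alpha\in[\tfrac{2\tau^3}{3},\infty)$, and let $f,g\in C^\infty(\mathbb R,\mathbb R)$ satisfy $\sup_{x\in\mathbb R}(|f(x)|+|g(x)|)<\infty$, $f((-\infty,\tau_1))\subseteq(0,\infty)$, $f([\tau_1,\infty))=\{0\}$, $f'(\mathbb R)\subseteq[-2,0]$, $f'((0,\tau))\subseteq[-2,-1)$, $g((-\infty,\tau_1])=\{0\}$, $g([\tau_2,\infty))=\{4\}$, $g'(\mathbb R)\subseteq[0,\infty)$, and $\alpha=\int_0^{\tau_1}|f(s)|^2\,ds$. Let $(\Omega,\mathcal F,\mathbb P)$ be a probability space with a normal filtration $\mathbb F=(\mathbb F_t)_{t\in[0,T]}$ (right-continuous, and every $\mathbb P$-null event in $\mathcal F$ belongs to $\mathbb F_0$), and let $W\colon[0,T]\times\Omega\to\mathbb R$ be a standard $\mathbb F$-Brownian motion with continuous sample paths. **Statement.** Let $a\in[0,\tau)$, $b\in(a,\tau]$, $c\in[2,\infty)$, let $\psi\in C^\infty(\mathbb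 R,\mathbb R)$ satisfy $\psi(x)=\frac{T^{3/2}}{(b-a)^{3/2}}(x-c)$ for all $x\in[c-2,c+2]$, let $X^{\psi,(1)},X^{\psi,(2)}\colon[0,T]\times\Omega\to\mathbb R$ be $\mathbb F$-adapted stochastic processes with continuous sample paths such that for every $t\in[0,T]$ it holds $\mathbb P$-a.s. that $$X^{\psi,(1)}_t=\int_0^t f(X^{\psi,(2)}_s)\,dW_s,\qquad X^{\psi,(2)}_t=t+\int_0^t g(X^{\psi,(2)}_s)\,[\cos(\psi(X^{\psi,(1)}_s))+1]\,ds ,$$ and let $u\colon C([0,a]\cup[b,T],\mathbb R)\to\mathbb R$ be a Borel measurable function, where $C([0,a]\cup[b,T],\mathbb R)$ carries the topology of uniform convergence. Then $$\mathbb E\Big[\big|X^{\psi,(2)}_T-u\big((W_s)_{s\in[0,a]\cup[b,T]}\big)\big|\Big]\;\ge\;\frac{\sqrt3\,(T-\tau_2)}{\pi\sqrt{T^3\alpha}}\left[\int_{c+1/2}^{c+1}e^{-x^2/\alpha}\,dx\right]\left[\int_0^1|\sin(y)|\,e^{-6y^2/T^3}\,dy\right]\;>\;0,$$ where the expectation takes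 values in $[0,\infty]$. -/

import Mathlib

open MeasureTheory ProbabilityTheory Filter Topology
open scoped ENNReal

/-! Processes on the time interval `[0,T]` are functions `Y : ℝ → Ω → ℝ` of which only the values at
times in `[0,T]` are ever used; filtrations are indexed by the interval `[0,T]` itself. -/

/-- A normal filtration on `[0,T]`: right-continuous, and every `P`-null event belongs to all
members of the filtration. -/
structure IsNormalFiltration {Ω : Type*} [mΩ : MeasurableSpace Ω] (P : Measure Ω) {T : ℝ}
    (𝔽 : Filtration (Set.Icc (0 : ℝ) T) mΩ) : Prop where
  rightCont : 𝔽.IsRightContinuous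
  null_mem : ∀ N : Set Ω, MeasurableSet N → P N = 0 → ∀ t, MeasurableSet[𝔽 t] N

/-- Stochastic processes on `[0,T]` which are adapted to `𝔽` and have continuous sample paths. -/
structure IsContinuousAdapted {Ω : Type*} [mΩ : MeasurableSpace Ω] {T : ℝ}
    (𝔽 : Filtration (Set.Icc (0 : ℝ) T) mΩ) (Y : ℝ → Ω → ℝ) : Prop where
  adapted : ∀ t : Set.Icc (0 : ℝ) T, Measurable[𝔽 t] (Y t)
  continuousOn : ∀ ω, ContinuousOn (fun t => Y t ω) (Set.Icc 0 T)

/-- Standard one-dimensional Brownian motion on `[0,T]` with respect to the filtration `𝔽`. -/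
structure IsStandardBrownianMotion {Ω : Type*} [mΩ : MeasurableSpace Ω] (P : Measure Ω) {T : ℝ}
    (𝔽 : Filtration (Set.Icc (0 : ℝ) T) mΩ) (W : ℝ → Ω → ℝ) : Prop
    extends IsContinuousAdapted 𝔽 W where
  zero : ∀ᵐ ω ∂P, W 0 ω = 0
  increment_law : ∀ s t : Set.Icc (0 : ℝ) T, s ≤ t →
    HasLaw (fun ω => W t ω - W s ω) (gaussianReal 0 (Real.toNNReal ((t : ℝ) - s))) P
  increment_indep : ∀ s t : Set.Icc (0 : ℝ) T, s ≤ t →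
    Indep (MeasurableSpace.comap (fun ω => W t ω - W s ω) (borel ℝ)) (𝔽 s) P

/-- A simple predictable integrand `∑_{i < n} ξᵢ 1_{(tᵢ, tᵢ₊₁]}` with times
`t₀ ≤ t₁ ≤ … ≤ tₙ` in `[0,T]` and bounded `𝔽_{tᵢ}`-measurable coefficients `ξᵢ`. -/
structure SimpleIntegrand {Ω : Type*} [mΩ : MeasurableSpace Ω] {T : ℝ}
    (𝔽 : Filtration (Set.Icc (0 : ℝ) T) mΩ) where
  n : ℕ
  time : ℕ → Set.Icc (0 : ℝ) T
  time_mono : Monotone time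
  coef : ℕ → Ω → ℝ
  coef_measurable : ∀ i, Measurable[𝔽 (time i)] (coef i)
  coef_bounded : ∀ i, ∃ C : ℝ, ∀ ω, |coef i ω| ≤ C

namespace SimpleIntegrand

/-- The value of the simple integrand at time `s`. -/
noncomputable def eval {Ω : Type*} [mΩ : MeasurableSpace Ω] {T : ℝ}
    {𝔽 : Filtration (Set.Icc (0 : ℝ) T) mΩ} (S : SimpleIntegrand 𝔽) (s : ℝ) (ω : Ω) : ℝ :=
  ∑ i ∈ Finset.range S.n,
    (Set.Ioc (S.time i : ℝ) (S.time (i + 1) : ℝ)).indicator (fun _ => S.coef i ω) s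

/-- The stochastic integral of the simple integrand with respect to `W` over `[0,t]`:
`∑_{i < n} ξᵢ (W_{tᵢ₊₁ ∧ t} - W_{tᵢ ∧ t})`. -/
noncomputable def integral {Ω : Type*} [mΩ : MeasurableSpace Ω] {T : ℝ}
    {𝔽 : Filtration (Set.Icc (0 : ℝ) T) mΩ} (S : SimpleIntegrand 𝔽) (W : ℝ → Ω → ℝ)
    (t : ℝ) (ω : Ω) : ℝ :=
  ∑ i ∈ Finset.range S.n,
    S.coef i ω * (W (min (S.time (i + 1) : ℝ) t) ω - W (min (S.time i : ℝ) t) ω)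

end SimpleIntegrand

/-- The random variable `I` is (a version of) the Itô integral `∫_0^t H_s dW_s` of the
square-integrable integrand `H`: there are simple integrands which converge to `H` in
`L²([0,t] × Ω)` and whose stochastic integrals over `[0,t]` converge to `I` in `L²(Ω)`.
(By the Itô isometry `I` is then determined up to null events, and does not depend on the
approximating sequence.) -/
def IsItoIntegral {Ω : Type*} [mΩ : MeasurableSpace Ω] (P : Measure Ω) {T : ℝ}
    (𝔽 : Filtration (Set.Icc (0 : ℝ) T) mΩ) (W : ℝ → Ω → ℝ) (H : ℝ → Ω → ℝ) (t : ℝ)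
    (I : Ω → ℝ) : Prop :=
  AEMeasurable (fun p : ℝ × Ω => H p.1 p.2) ((volume.restrict (Set.Icc 0 t)).prod P) ∧
  AEMeasurable I P ∧
  ∃ S : ℕ → SimpleIntegrand 𝔽,
    Tendsto (fun k => ∫⁻ ω, ∫⁻ s in Set.Icc 0 t,
      ENNReal.ofReal (|(S k).eval s ω - H s ω| ^ 2) ∂volume ∂P) atTop (𝓝 0) ∧
    Tendsto (fun k => ∫⁻ ω, ENNReal.ofReal (|(S k).integral W t ω - I ω| ^ 2) ∂P) atTop (𝓝 0)

/-- The set `[0,a] ∪ [b,T]` of times at which the Brownian path is observed. -/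
def observedTimes (a b T : ℝ) : Set ℝ := Set.Icc 0 a ∪ Set.Icc b T

theorem observedTimes_subset {a b T : ℝ} (hb : 0 ≤ b) (ha : a ≤ T) :
    observedTimes a b T ⊆ Set.Icc 0 T :=
  Set.union_subset (Set.Icc_subset_Icc le_rfl ha) (Set.Icc_subset_Icc hb le_rfl)

/-- The restriction to `K` of a path which is continuous on `D ⊇ K`, as an element of
`C(K, ℝ)`. -/
def restrictPath {K D : Set ℝ} (w : ℝ → ℝ) (hw : ContinuousOn w D) (hK : K ⊆ D) : C(K, ℝ) where
  toFun s := w s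
  continuous_toFun := (hw.mono hK).domRestrict

/-! The bound is a conditional symmetry argument. Since `g` vanishes left of `τ₁`, the second
component is `X₂ t = t` up to time `τ₁` and satisfies `X₂ t ≥ t` afterwards. Hence `f (X₂ s) = f s`
throughout, so `X₁` is a Wiener integral of `f`, and from `τ₁` on it is frozen at a single Gaussian
variable, which integration by parts writes pathwise as `-∫ f' W` (`ae_eq_of_isItoIntegral`). With
the noise frozen, `X₂` solves the autonomous equation `x' = 1 + γ g(x)` with `γ = cos (ψ X₁) + 1`.
Its value at `T` is an explicit function of `γ` which separates different `γ` at rate at least `4 (T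
- τ₂)` (`ae_terminal_eq`, `le_abs_terminalValue_sub`).

Subtracting from `W` on `[a,b]` its linear interpolation splits the Gaussian variable into `Y + Z`.
Here `Y` is a functional of the observed path, and `Z` is a weighted integral of a Brownian bridge,
independent of the observations and of variance comparable to `(b - a)³`
(`exists_wienerIntegral_eq_add`). Given the observations, `Z` and `-Z` have the same law. Writing
`Γ` for the terminal value as a function of `Y + Z`, every estimator therefore has mean error at
least half the mean of `|Γ(Y + Z) - Γ(Y - Z)|` (`mul_mul_le_lintegral_abs_sub`). Near `c` the
function `ψ` is affine with slope `k = (T / (b - a))^(3/2)`, so the difference of the cosines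
factors as `2 |sin (k (Y - c))| |sin (k Z)|`, and the bound becomes a product of two Gaussian
expectations.

The slope is such that `k Z` has variance comparable to `T³` whatever `b - a` is, which controls the
second factor (`le_setLIntegral_abs_sin_mul`). In the first factor the oscillation of the sine costs
at most a factor four, uniformly in `k ≥ 1` (`integral_le_four_mul_integral_abs_sin_mul`,
`le_setLIntegral_abs_sin_mul_sub`). The assumption on `α` ensures that `Y` keeps at least half of
the total variance `α`. -/

set_option linter.unusedSectionVars false

/-! ### Brownian motion: Gaussianity, increments and covariance. -/

/-- Extension of a process on `[0,T]` to all times, constant outside of `[0,T]`. -/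
noncomputable def clampedPath {Ω : Type*} (T : ℝ) (W : ℝ → Ω → ℝ) (s : ℝ) (ω : Ω) : ℝ :=
  W (max 0 (min T s)) ω

theorem clampedPath_of_mem {Ω : Type*} {T : ℝ} {W : ℝ → Ω → ℝ} {s : ℝ}
    (hs : s ∈ Set.Icc 0 T) : clampedPath T W s = W s := by
  funext ω
  simp [clampedPath, min_eq_right hs.2, max_eq_right hs.1]

/-- Induction on the largest index `a` of a finite family: all earlier variables are known to `m a`,
of which `X a` is independent, so the last factor splits off. -/
theorem iIndepFun_of_indep_filtration {Ω : Type*} {mΩ : MeasurableSpace Ω} {P : Measure Ω}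
    [IsProbabilityMeasure P] {ι : Type*} [LinearOrder ι] {m : ι → MeasurableSpace Ω}
    {X : ι → Ω → ℝ}
    (hm : ∀ i j, i < j → Measurable[m j] (X i))
    (hind : ∀ i, Indep (MeasurableSpace.comap (X i) inferInstance) (m i) P) :
    iIndepFun X P := by
  rw [iIndepFun_iff]
  intro S
  induction S using Finset.induction_on_max with
  | empty => simp
  | insert a s ha ih =>
    intro f hf
    have has : a ∉ s := fun h => (ha a h).false
    rw [Finset.set_biInter_insert, Finset.prod_insert has,
      ← ih (fun i hi => hf i (Finset.mem_insert_of_mem hi))]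
    refine Indep_iff _ _ _ |>.1 (hind a) _ _ (hf a (Finset.mem_insert_self _ _)) ?_
    refine Finset.measurableSet_biInter _ fun i hi => ?_
    obtain ⟨B, hB, hBf⟩ := hf i (Finset.mem_insert_of_mem hi)
    rw [← hBf]
    exact hm i a (ha i hi) hB

namespace IsStandardBrownianMotion

variable {Ω : Type*} [mΩ : MeasurableSpace Ω] {P : Measure Ω} [IsProbabilityMeasure P] {T : ℝ}
  {𝔽 : Filtration (Set.Icc (0 : ℝ) T) mΩ} {W : ℝ → Ω → ℝ}

theorem measurable (hW : IsStandardBrownianMotion P 𝔽 W) (t : Set.Icc (0 : ℝ) T) :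
    Measurable (W t) :=
  (hW.adapted t).mono (𝔽.le t) le_rfl

theorem measurable_of_le (hW : IsStandardBrownianMotion P 𝔽 W) {s t : Set.Icc (0 : ℝ) T}
    (h : s ≤ t) : Measurable[𝔽 t] (W s) :=
  (hW.adapted s).mono (𝔽.mono h) le_rfl

theorem hasIndepIncrements (hW : IsStandardBrownianMotion P 𝔽 W) :
    HasIndepIncrements (fun (t : Set.Icc (0 : ℝ) T) ω => W t ω) P := by
  intro n t ht
  refine iIndepFun_of_indep_filtration (m := fun i => 𝔽 (t i.castSucc))
    (fun i j hij => ?_) (fun i => ?_)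
  · exact (hW.measurable_of_le (ht (Fin.succ_le_castSucc_iff.2 hij))).sub
      (hW.measurable_of_le (ht (Fin.castSucc_le_castSucc_iff.2 hij.le)))
  · have := hW.increment_indep (t i.castSucc) (t i.succ) (ht (Fin.castSucc_le_succ i))
    rwa [← BorelSpace.measurable_eq (α := ℝ)] at this

theorem hasLaw_eval (hW : IsStandardBrownianMotion P 𝔽 W) (t : Set.Icc (0 : ℝ) T) :
    HasLaw (W t) (gaussianReal 0 (Real.toNNReal t)) P := by
  have h0 : (0 : ℝ) ∈ Set.Icc (0 : ℝ) T := ⟨le_rfl, t.2.1.trans t.2.2⟩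
  have := hW.increment_law ⟨0, h0⟩ t t.2.1
  rw [show ((t : ℝ) - ((⟨0, h0⟩ : Set.Icc (0 : ℝ) T) : ℝ)) = t from sub_zero _] at this
  refine this.congr ?_
  filter_upwards [hW.zero] with ω hω
  simp [hω]

theorem isGaussianProcess (hW : IsStandardBrownianMotion P 𝔽 W) (hT : 0 ≤ T) :
    IsGaussianProcess (fun (t : Set.Icc (0 : ℝ) T) ω => W t ω) P := by
  have : Fact ((0 : ℝ) ≤ T) := ⟨hT⟩
  refine HasIndepIncrements.isGaussianProcess (fun t => (hW.hasLaw_eval t).hasGaussianLaw) ?_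
    hW.hasIndepIncrements
  exact hW.zero

theorem isGaussianProcess_clamped (hW : IsStandardBrownianMotion P 𝔽 W) (hT : 0 ≤ T) :
    IsGaussianProcess (clampedPath T W) P :=
  (hW.isGaussianProcess hT).comp_right (fun s : ℝ => Set.projIcc 0 T hT s)

theorem measurable_clamped (hW : IsStandardBrownianMotion P 𝔽 W) (hT : 0 ≤ T) (s : ℝ) :
    Measurable (clampedPath T W s) :=
  hW.measurable (Set.projIcc 0 T hT s)

theorem continuous_clamped (hW : IsStandardBrownianMotion P 𝔽 W) (hT : 0 ≤ T) (ω : Ω) :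
    Continuous (fun s => clampedPath T W s ω) :=
  (hW.continuousOn ω).comp_continuous (by fun_prop)
    (fun s => (Set.projIcc 0 T hT s).2)

theorem memLp_clamped (hW : IsStandardBrownianMotion P 𝔽 W) (hT : 0 ≤ T) (s : ℝ) :
    MemLp (clampedPath T W s) 2 P :=
  ((hW.isGaussianProcess_clamped hT).hasGaussianLaw_eval s).memLp_two

theorem indepFun_increment (hW : IsStandardBrownianMotion P 𝔽 W) {s t : Set.Icc (0 : ℝ) T}
    (hst : s ≤ t) {ξ : Ω → ℝ} (hξ : Measurable[𝔽 s] ξ) :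
    IndepFun ξ (fun ω => W t ω - W s ω) P := by
  have := (hW.increment_indep s t hst).symm
  rw [← BorelSpace.measurable_eq (α := ℝ)] at this
  exact indep_of_indep_of_le_left this hξ.comap_le

theorem integral_increment (hW : IsStandardBrownianMotion P 𝔽 W) {s t : Set.Icc (0 : ℝ) T}
    (hst : s ≤ t) : ∫ ω, (W t ω - W s ω) ∂P = 0 := by
  rw [(hW.increment_law s t hst).integral_eq, integral_id_gaussianReal]

theorem integral_increment_sq (hW : IsStandardBrownianMotion P 𝔽 W) {s t : Set.Icc (0 : ℝ) T}
    (hst : s ≤ t) : ∫ ω, (W t ω - W s ω) ^ 2 ∂P = t - s := by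
  have h := (hW.increment_law s t hst).variance_eq
  rw [variance_eq_integral (X := fun ω => W t ω - W s ω)
      ((hW.measurable t).sub (hW.measurable s)).aemeasurable,
    hW.integral_increment hst, variance_id_gaussianReal,
    Real.coe_toNNReal _ (sub_nonneg.2 hst)] at h
  simpa using h

theorem integral_mul_increment (hW : IsStandardBrownianMotion P 𝔽 W) {s t : Set.Icc (0 : ℝ) T}
    (hst : s ≤ t) {ξ : Ω → ℝ} (hξ : Measurable[𝔽 s] ξ) :
    ∫ ω, ξ ω * (W t ω - W s ω) ∂P = 0 := by
  have := (hW.indepFun_increment hst hξ).integral_fun_mul_eq_mul_integral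
    (hξ.mono (𝔽.le s) le_rfl).aestronglyMeasurable
    ((hW.measurable t).sub (hW.measurable s)).aestronglyMeasurable
  rw [this, hW.integral_increment hst, mul_zero]

theorem integral_mul_increment_sq (hW : IsStandardBrownianMotion P 𝔽 W)
    {s t : Set.Icc (0 : ℝ) T} (hst : s ≤ t) {ξ : Ω → ℝ} (hξ : Measurable[𝔽 s] ξ) :
    ∫ ω, ξ ω * (W t ω - W s ω) ^ 2 ∂P = (∫ ω, ξ ω ∂P) * (t - s) := by
  have := ((hW.indepFun_increment hst hξ).comp measurable_id
      (measurable_id.pow_const 2)).integral_fun_mul_eq_mul_integral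
    (hξ.mono (𝔽.le s) le_rfl).aestronglyMeasurable
    (((hW.measurable t).sub (hW.measurable s)).pow_const 2).aestronglyMeasurable
  simp only [Function.comp_def, id] at this
  rw [this, hW.integral_increment_sq hst]

theorem memLp_eval (hW : IsStandardBrownianMotion P 𝔽 W) (t : Set.Icc (0 : ℝ) T) :
    MemLp (W t) 2 P :=
  (hW.hasLaw_eval t).hasGaussianLaw.memLp_two

theorem memLp_increment (hW : IsStandardBrownianMotion P 𝔽 W) (s t : Set.Icc (0 : ℝ) T) :
    MemLp (fun ω => W t ω - W s ω) 2 P :=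
  (hW.memLp_eval t).sub (hW.memLp_eval s)

/-- Only the overlap of `(s,t]` with `[0,r]` contributes. The part of `W r` before `s` is absorbed
into the coefficient, and the part after `t` has mean zero given the past. The bound on `ξ` serves
integrability. -/
theorem integral_mul_increment_mul_eval (hW : IsStandardBrownianMotion P 𝔽 W)
    {s t : Set.Icc (0 : ℝ) T} (hst : s ≤ t) (r : Set.Icc (0 : ℝ) T) {ξ : Ω → ℝ}
    (hξ : Measurable[𝔽 s] ξ) {C : ℝ} (hC : ∀ ω, |ξ ω| ≤ C) :
    ∫ ω, ξ ω * (W t ω - W s ω) * W r ω ∂P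
      = (∫ ω, ξ ω ∂P) * (min (t : ℝ) r - min (s : ℝ) r) := by
  have hint : ∀ u v : Ω → ℝ, MemLp u 2 P → MemLp v 2 P →
      Integrable (fun ω => ξ ω * (u ω * v ω)) P := fun u v hu hv =>
    (hu.integrable_mul hv).bdd_mul (hξ.mono (𝔽.le s) le_rfl).aestronglyMeasurable
      (ae_of_all _ hC)
  rcases le_total r s with hrs | hsr
  · have h1 : min (t : ℝ) r - min (s : ℝ) r = 0 := by
      rw [min_eq_right (show (r : ℝ) ≤ t from hrs.trans hst), min_eq_right (show (r : ℝ) ≤ s from hrs),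
        sub_self]
    rw [h1, mul_zero]
    refine Eq.trans ?_ (hW.integral_mul_increment hst (hξ.mul (hW.measurable_of_le hrs)))
    exact integral_congr_ae (ae_of_all _ fun ω => by simp only [Pi.mul_apply]; ring)
  · have key : ∀ m : Set.Icc (0 : ℝ) T, s ≤ m →
        ∫ ω, ξ ω * ((W m ω - W s ω) * W m ω) ∂P = (∫ ω, ξ ω ∂P) * (m - s) := by
      intro m hsm
      have e : ∀ ω, ξ ω * ((W m ω - W s ω) * W m ω)
          = ξ ω * ((W m ω - W s ω) * (W m ω - W s ω)) + ξ ω * (W s ω * (W m ω - W s ω)) := by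
        intro ω; ring
      simp_rw [e]
      have hd := hW.memLp_increment s m
      rw [integral_add (hint _ _ hd hd) (hint _ _ (hW.memLp_eval s) hd)]
      have h2 := hW.integral_mul_increment hsm (hξ.mul (hW.adapted s))
      have h3 := hW.integral_mul_increment_sq hsm hξ
      simp only [Pi.mul_apply, mul_assoc] at h2
      rw [h2, add_zero, ← h3]
      simp_rw [pow_two]
    rcases le_total r t with hrt | htr
    · have e : ∀ ω, ξ ω * (W t ω - W s ω) * W r ω
          = ξ ω * (W r ω * (W t ω - W r ω)) + ξ ω * ((W r ω - W s ω) * W r ω) := by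
        intro ω; ring
      simp_rw [e]
      rw [integral_add (hint _ _ (hW.memLp_eval r) (hW.memLp_increment r t))
        (hint _ _ (hW.memLp_increment s r) (hW.memLp_eval r)), key r hsr]
      have h2 := hW.integral_mul_increment hrt ((hξ.mono (𝔽.mono hsr) le_rfl).mul (hW.adapted r))
      simp only [Pi.mul_apply, mul_assoc] at h2
      rw [h2, zero_add, min_eq_right (by exact_mod_cast hrt), min_eq_left (by exact_mod_cast hsr)]
    · have e : ∀ ω, ξ ω * (W t ω - W s ω) * W r ω
          = ξ ω * ((W t ω - W s ω) * (W r ω - W t ω)) + ξ ω * ((W t ω - W s ω) * W t ω) := by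
        intro ω; ring
      simp_rw [e]
      have hd := hW.memLp_increment s t
      rw [integral_add (hint _ _ hd (hW.memLp_increment t r))
        (hint _ _ hd (hW.memLp_eval t)), key t hst]
      have h2 := hW.integral_mul_increment htr ((hξ.mono (𝔽.mono hst) le_rfl).mul
        ((hW.adapted t).sub (hW.measurable_of_le hst)))
      simp only [Pi.mul_apply, Pi.sub_apply, mul_assoc] at h2
      rw [h2, zero_add, min_eq_left (by exact_mod_cast htr), min_eq_left (by exact_mod_cast hsr)]

theorem integral_eval_mul_eval (hW : IsStandardBrownianMotion P 𝔽 W)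
    (s r : Set.Icc (0 : ℝ) T) : ∫ ω, W s ω * W r ω ∂P = min (s : ℝ) r := by
  have h0 : (0 : ℝ) ∈ Set.Icc (0 : ℝ) T := ⟨le_rfl, s.2.1.trans s.2.2⟩
  have := hW.integral_mul_increment_mul_eval (s := ⟨0, h0⟩) (t := s) s.2.1 r (ξ := fun _ => 1)
    measurable_const (C := 1) (by simp)
  simp only [one_mul, integral_const, probReal_univ, smul_eq_mul, mul_one,
    min_eq_left r.2.1, sub_zero] at this
  rw [← this]
  refine integral_congr_ae ?_
  filter_upwards [hW.zero] with ω hω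
  simp [hω]

end IsStandardBrownianMotion

/-! ### Riemann sums of continuous functions. -/

/-- The left-endpoint Riemann sum of `k` over `n + 1` equal steps from `p` to `q`. -/
noncomputable def leftRiemannSum (p q : ℝ) (k : ℝ → ℝ) (n : ℕ) : ℝ :=
  ∑ j ∈ Finset.range (n + 1), (q - p) / (n + 1 : ℝ) * k (p + j * ((q - p) / (n + 1 : ℝ)))

/-- Path integrals are pathwise limits of these finite linear combinations of path values, which is
how they inherit measurability and Gaussianity. The proof is uniform continuity on the compact
interval. -/
theorem tendsto_leftRiemannSum {k : ℝ → ℝ} (hk : Continuous k) (p q : ℝ) :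
    Tendsto (leftRiemannSum p q k) atTop (𝓝 (∫ s in p..q, k s)) := by
  have huc : UniformContinuousOn k (Set.uIcc p q) :=
    isCompact_uIcc.uniformContinuousOn_of_continuous hk.continuousOn
  rw [Metric.tendsto_atTop]
  intro ε hε
  have hε' : 0 < ε / (|q - p| + 1) := by positivity
  obtain ⟨δ, hδ, hd⟩ := Metric.uniformContinuousOn_iff.1 huc _ hε'
  obtain ⟨N, hN⟩ := exists_nat_gt (|q - p| / δ)
  refine ⟨N, fun n hn => ?_⟩
  have hn0 : (0 : ℝ) < (n : ℝ) + 1 := by positivity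
  set e : ℝ := (q - p) / (n + 1 : ℝ) with he
  set t : ℕ → ℝ := fun j => p + j * e with ht
  have hne : ((n : ℝ) + 1) * e = q - p := by rw [he]; field_simp
  have hstep : |e| < δ := by
    rw [he, abs_div, abs_of_pos hn0, div_lt_iff₀ hn0]
    rw [div_lt_iff₀ hδ] at hN
    have : (N : ℝ) ≤ n := by exact_mod_cast hn
    nlinarith
  have hmem : ∀ j : ℕ, j ≤ n + 1 → t j ∈ Set.uIcc p q := by
    intro j hj
    have h1 : (j : ℝ) / (n + 1) ∈ Set.Icc (0 : ℝ) 1 := by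
      refine ⟨by positivity, (div_le_one hn0).2 (by exact_mod_cast hj)⟩
    have h2 : t j = AffineMap.lineMap p q ((j : ℝ) / (n + 1)) := by
      simp only [ht, he, AffineMap.lineMap_apply, vsub_eq_sub, smul_eq_mul, vadd_eq_add]
      ring
    rw [h2, ← segment_eq_uIcc, segment_eq_image_lineMap]
    exact ⟨_, h1, rfl⟩
  have hsum : ∫ s in p..q, k s = ∑ j ∈ Finset.range (n + 1), ∫ s in (t j)..(t (j + 1)), k s := by
    rw [intervalIntegral.sum_integral_adjacent_intervals
      (fun j _ => hk.intervalIntegrable _ _)]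
    congr 1
    · simp [ht]
    · simp only [ht]; push_cast; rw [hne]; ring
  have hte : ∀ j : ℕ, t (j + 1) - t j = e := by
    intro j; simp only [ht]; push_cast; ring
  have hterm : ∀ j ∈ Finset.range (n + 1),
      |e * k (t j) - ∫ s in (t j)..(t (j + 1)), k s| ≤ ε / (|q - p| + 1) * |e| := by
    intro j hj
    have hj' : j + 1 ≤ n + 1 := Finset.mem_range.1 hj
    have h1 : e * k (t j) - ∫ s in (t j)..(t (j + 1)), k s
        = ∫ s in (t j)..(t (j + 1)), (k (t j) - k s) := by
      rw [intervalIntegral.integral_sub (by simp) (hk.intervalIntegrable _ _),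
        intervalIntegral.integral_const, hte, smul_eq_mul]
    rw [h1, ← Real.norm_eq_abs]
    refine (intervalIntegral.norm_integral_le_of_norm_le_const (C := ε / (|q - p| + 1))
      fun s hs => ?_).trans (by rw [hte])
    have hsI : s ∈ Set.uIcc (t j) (t (j + 1)) := Set.uIoc_subset_uIcc hs
    have hs2 : s ∈ Set.uIcc p q :=
      Set.uIcc_subset_uIcc (hmem j (by omega)) (hmem (j + 1) hj') hsI
    refine (hd _ (hmem j (by omega)) s hs2 ?_).le
    rw [Real.dist_eq, abs_sub_comm]
    refine (Set.abs_sub_left_of_mem_uIcc hsI).trans_lt ?_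
    rwa [hte]
  rw [Real.dist_eq, leftRiemannSum, hsum, ← Finset.sum_sub_distrib]
  refine (Finset.abs_sum_le_sum_abs _ _).trans_lt ((Finset.sum_le_sum hterm).trans_lt ?_)
  rw [Finset.sum_const, Finset.card_range, nsmul_eq_mul]
  have h3 : ((n + 1 : ℕ) : ℝ) * (ε / (|q - p| + 1) * |e|) = ε / (|q - p| + 1) * |q - p| := by
    rw [← hne, abs_mul, abs_of_pos hn0]; push_cast; ring
  rw [h3, div_mul_eq_mul_div, div_lt_iff₀ (by positivity)]
  nlinarith [abs_nonneg (q - p)]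

/-! ### Stability of centred Gaussian families under linear combinations and limits. -/

section GaussianLimits

variable {Ω : Type*} {mΩ : MeasurableSpace Ω} {P : Measure Ω} [IsProbabilityMeasure P]

theorem tendsto_charFun_map {Z : ℕ → Ω → ℝ} {Z' : Ω → ℝ} (hZ : ∀ n, AEMeasurable (Z n) P)
    (hZ' : AEMeasurable Z' P) (h : ∀ᵐ ω ∂P, Tendsto (fun n => Z n ω) atTop (𝓝 (Z' ω))) (t : ℝ) :
    Tendsto (fun n => charFun (P.map (Z n)) t) atTop (𝓝 (charFun (P.map Z') t)) := by
  have e : ∀ {Y : Ω → ℝ}, AEMeasurable Y P →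
      charFun (P.map Y) t = ∫ ω, Complex.exp (t * Y ω * Complex.I) ∂P := by
    intro Y hY
    rw [charFun_apply_real, integral_map hY]
    exact Continuous.aestronglyMeasurable (by fun_prop)
  rw [e hZ']
  simp_rw [fun n => e (hZ n)]
  refine tendsto_integral_of_dominated_convergence (fun _ => 1) (fun n => ?_)
    (integrable_const _) (fun n => ae_of_all _ fun ω => ?_) ?_
  · have := (hZ n).aestronglyMeasurable
    exact (Continuous.comp_aestronglyMeasurable
      (g := fun x : ℝ => Complex.exp (t * x * Complex.I)) (by fun_prop) this)
  · rw [← Complex.ofReal_mul, Complex.norm_exp_ofReal_mul_I]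
  · filter_upwards [h] with ω hω
    exact ((Continuous.tendsto (f := fun x : ℝ => Complex.exp (t * x * Complex.I))
      (by fun_prop) _).comp hω)

/-- The characteristic functions `exp (-σₙ² t² / 2)` converge, and their limit at `t ≠ 0` is `ρ ^
(t²)`, where `ρ` is the limit at `1`. This identifies a Gaussian of variance `-2 log ρ` without any
prior convergence of the variances. -/
theorem hasGaussianLaw_of_tendsto_ae {Z : ℕ → Ω → ℝ} {Z' : Ω → ℝ}
    (hZ : ∀ n, HasGaussianLaw (Z n) P) (h0 : ∀ n, ∫ ω, Z n ω ∂P = 0) (hZ' : AEMeasurable Z' P)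
    (h : ∀ᵐ ω ∂P, Tendsto (fun n => Z n ω) atTop (𝓝 (Z' ω))) : HasGaussianLaw Z' P := by
  have hlaw : ∀ n, P.map (Z n) = gaussianReal 0 (Var[Z n; P]).toNNReal := by
    intro n
    rw [(hZ n).map_eq_gaussianReal, h0]
  have hc : ∀ n (t : ℝ), charFun (P.map (Z n)) t
      = ((Real.exp (-(Var[Z n; P]) * t ^ 2 / 2) : ℝ) : ℂ) := by
    intro n t
    rw [hlaw, charFun_gaussianReal, Real.coe_toNNReal _ (variance_nonneg _ _)]
    push_cast
    congr 1
    ring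
  have hlim := fun t => tendsto_charFun_map (fun n => (hZ n).aemeasurable) hZ' h t
  have : IsProbabilityMeasure (P.map Z') := Measure.isProbabilityMeasure_map hZ'
  have hlimR : ∀ t : ℝ, Tendsto (fun n => Real.exp (-(Var[Z n; P]) * t ^ 2 / 2)) atTop
      (𝓝 (charFun (P.map Z') t).re) := by
    intro t
    have := (Complex.continuous_re.tendsto _).comp (hlim t)
    refine this.congr fun n => ?_
    simp only [Function.comp, hc, Complex.ofReal_re]
  have him : ∀ t : ℝ, charFun (P.map Z') t = ((charFun (P.map Z') t).re : ℂ) := by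
    intro t
    have h1 := (Complex.continuous_im.tendsto _).comp (hlim t)
    have h2 : (charFun (P.map Z') t).im = 0 := by
      refine tendsto_nhds_unique h1 ?_
      simp only [Function.comp_def, hc, Complex.ofReal_im]
      exact tendsto_const_nhds
    apply Complex.ext <;> simp [h2]
  set ρ := (charFun (P.map Z') 1).re with hρ
  have hpow : ∀ t : ℝ, t ≠ 0 → (charFun (P.map Z') t).re = ρ ^ (t ^ 2) := by
    intro t ht
    refine tendsto_nhds_unique (hlimR t) ?_
    have := (hlimR 1).rpow_const (p := t ^ 2) (Or.inr (by positivity))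
    refine this.congr fun n => ?_
    rw [← Real.exp_mul]
    congr 1
    ring
  have hρ0 : 0 ≤ ρ := ge_of_tendsto' (hlimR 1) fun n => (Real.exp_pos _).le
  have hρ1 : ρ ≤ 1 := by
    refine le_of_tendsto' (hlimR 1) fun n => ?_
    rw [Real.exp_le_one_iff]
    have := variance_nonneg (Z n) P
    nlinarith
  -- If `ρ` were zero, the variances would escape to infinity and the limit would vanish off the
  -- origin; a characteristic function is continuous with value `1` at `0`.
  have hρpos : 0 < ρ := by
    rcases hρ0.lt_or_eq with h | h
    · exact h
    · exfalso
      have hcont : Continuous (fun t => (charFun (P.map Z') t).re) :=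
        Complex.continuous_re.comp continuous_charFun
      have h1 : Tendsto (fun t => (charFun (P.map Z') t).re) (𝓝[≠] 0) (𝓝 1) := by
        have := (hcont.tendsto 0).mono_left (nhdsWithin_le_nhds (s := {0}ᶜ))
        simpa using this
      have h2 : Tendsto (fun t => (charFun (P.map Z') t).re) (𝓝[≠] 0) (𝓝 0) := by
        refine tendsto_const_nhds.congr' ?_
        filter_upwards [self_mem_nhdsWithin] with t ht
        rw [hpow t ht, ← h, Real.zero_rpow (pow_ne_zero 2 ht)]
      exact zero_ne_one (tendsto_nhds_unique h2 h1)
  have hlog : Real.log ρ ≤ 0 := Real.log_nonpos hρ0 hρ1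
  have : P.map Z' = gaussianReal 0 (-(2 * Real.log ρ)).toNNReal := by
    apply Measure.ext_of_charFun
    ext t
    rw [charFun_gaussianReal, Real.coe_toNNReal _ (by linarith)]
    rcases eq_or_ne t 0 with rfl | ht
    · simp
    · rw [him t, hpow t ht, Real.rpow_def_of_pos hρpos]
      push_cast
      congr 1
      ring
  refine ⟨?_⟩
  rw [this]
  infer_instance

variable {ι κ : Type*}

theorem isGaussianProcess_of_mem_span {X : ι → Ω → ℝ} (hX : IsGaussianProcess X P)
    {Y : κ → Ω → ℝ} (hY : ∀ i, Y i ∈ Submodule.span ℝ (Set.range X)) : IsGaussianProcess Y P := by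
  refine hX.of_isGaussianProcess fun s => ?_
  obtain ⟨c, hc⟩ := (Finsupp.mem_span_range_iff_exists_finsupp).1 (hY s)
  refine ⟨c.support, ∑ i : c.support, c i • ContinuousLinearMap.proj i, fun ω => ?_⟩
  rw [← hc, Finsupp.sum]
  simp only [Finset.sum_apply, Pi.smul_apply, smul_eq_mul, sum_apply,
    smul_apply, ContinuousLinearMap.proj_apply, Finset.restrict]
  exact (Finset.sum_coe_sort c.support (fun i => c i * X i ω)).symm

theorem integral_eq_zero_of_mem_span {X : ι → Ω → ℝ} (hX : ∀ i, Integrable (X i) P)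
    (h0 : ∀ i, ∫ ω, X i ω ∂P = 0) {Y : Ω → ℝ} (hY : Y ∈ Submodule.span ℝ (Set.range X)) :
    Integrable Y P ∧ ∫ ω, Y ω ∂P = 0 := by
  induction hY using Submodule.span_induction with
  | mem x hx => obtain ⟨i, rfl⟩ := hx; exact ⟨hX i, h0 i⟩
  | zero => exact ⟨integrable_zero _ _ _, by simp⟩
  | add x y _ _ hx hy =>
    refine ⟨hx.1.add hy.1, ?_⟩
    simp only [Pi.add_apply]
    rw [integral_add hx.1 hy.1, hx.2, hy.2, add_zero]
  | smul a x _ hx =>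
    refine ⟨hx.1.smul a, ?_⟩
    simp only [Pi.smul_apply, smul_eq_mul]
    rw [integral_const_mul, hx.2, mul_zero]

/-- By testing finite-dimensional marginals against linear forms, everything reduces to the
real-valued limit theorem. -/
theorem isGaussianProcess_of_tendsto_ae {X : ℕ → ι → Ω → ℝ} {Y : ι → Ω → ℝ}
    (hX : ∀ n, IsGaussianProcess (X n) P) (h0 : ∀ n i, ∫ ω, X n i ω ∂P = 0)
    (hY : ∀ i, AEMeasurable (Y i) P)
    (h : ∀ i, ∀ᵐ ω ∂P, Tendsto (fun n => X n i ω) atTop (𝓝 (Y i ω))) :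
    IsGaussianProcess Y P := by
  classical
  refine ⟨fun I => ⟨?_⟩⟩
  have hm : AEMeasurable (fun ω => I.restrict (Y · ω)) P :=
    aemeasurable_pi_lambda _ fun i => hY i
  refine isGaussian_of_isGaussian_map fun L => ?_
  rw [AEMeasurable.map_map_of_aemeasurable (by fun_prop) hm]
  refine (hasGaussianLaw_of_tendsto_ae (Z := fun n => L ∘ fun ω => I.restrict (X n · ω))
    (fun n => ((hX n).hasGaussianLaw I).map L) (fun n => ?_) (by fun_prop) ?_).isGaussian_map
  · have e : (L ∘ fun ω => I.restrict (X n · ω))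
        = fun ω => ∑ i : I, L (Pi.single i 1) * X n i ω := by
      funext ω
      have h2 : I.restrict (X n · ω) = ∑ i : I, Pi.single i (X n i ω) :=
        (Finset.univ_sum_single _).symm
      rw [Function.comp_apply, h2, map_sum]
      refine Finset.sum_congr rfl fun i _ => ?_
      rw [mul_comm, ← smul_eq_mul, ← map_smul, ← Pi.single_smul]
      simp
    rw [e, integral_finsetSum]
    · exact Finset.sum_eq_zero fun i _ => by rw [integral_const_mul, h0, mul_zero]
    · intro i _
      exact ((hX n).hasGaussianLaw_eval i).integrable.const_mul _
  · have : ∀ᵐ ω ∂P, ∀ i : I, Tendsto (fun n => X n i ω) atTop (𝓝 (Y i ω)) :=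
      ae_all_iff.2 fun i => h i
    filter_upwards [this] with ω hω
    exact (L.continuous.tendsto _).comp (tendsto_pi_nhds.2 hω)

end GaussianLimits

/-! ### Weighted integrals of the Brownian path and their covariances. -/

/-- The pathwise integral `∫_p^q h(s) W_s ds` of the path extended beyond `[0,T]`. -/
noncomputable def weightedPathIntegral {Ω : Type*} (T : ℝ) (W : ℝ → Ω → ℝ) (h : ℝ → ℝ)
    (p q : ℝ) (ω : Ω) : ℝ :=
  ∫ s in p..q, h s * clampedPath T W s ω

/-- The family of all values of the path together with all its weighted integrals. -/
noncomputable def pathFunctional {Ω : Type*} (T : ℝ) (W : ℝ → Ω → ℝ) :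
    ℝ ⊕ (ℝ × ℝ × C(ℝ, ℝ)) → Ω → ℝ
  | Sum.inl s => clampedPath T W s
  | Sum.inr (p, q, h) => weightedPathIntegral T W h p q

/-- Integrate by parts on `[0,r]`, where the minimum is `s`, and use the fundamental theorem on
`[r,T]`, where it is constant; the boundary terms `f r * r` cancel. As `min s r` is the Brownian
covariance, this computes the covariance of `W r` with `∫ f' W`. -/
theorem integral_deriv_mul_min {f : ℝ → ℝ} (hf : ContDiff ℝ (⊤ : ℕ∞) f) {r T : ℝ}
    (hr : r ∈ Set.Icc 0 T) (hfT : f T = 0) :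
    ∫ s in (0 : ℝ)..T, deriv f s * min s r = -∫ s in (0 : ℝ)..r, f s := by
  have hd : Continuous (deriv f) := hf.continuous_deriv (by simp)
  have hdf : ∀ s, HasDerivAt f (deriv f s) s := fun s =>
    (hf.differentiable (by simp) s).hasDerivAt
  have hi : ∀ a b, IntervalIntegrable (fun s => deriv f s * min s r) volume a b := fun a b =>
    Continuous.intervalIntegrable (by fun_prop) _ _
  rw [← intervalIntegral.integral_add_adjacent_intervals (hi 0 r) (hi r T)]
  have h1 : ∫ s in (0 : ℝ)..r, deriv f s * min s r = ∫ s in (0 : ℝ)..r, deriv f s * s := by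
    refine intervalIntegral.integral_congr fun s hs => ?_
    rw [Set.uIcc_of_le hr.1] at hs
    simp only [min_eq_left hs.2]
  have h2 : ∫ s in r..T, deriv f s * min s r = ∫ s in r..T, deriv f s * r := by
    refine intervalIntegral.integral_congr fun s hs => ?_
    rw [Set.uIcc_of_le hr.2] at hs
    simp only [min_eq_right hs.1]
  have h3 : ∫ s in (0 : ℝ)..r, deriv f s * s = f r * r - f 0 * 0 - ∫ s in (0 : ℝ)..r, f s := by
    have := intervalIntegral.integral_deriv_mul_eq_sub_of_hasDerivAt (a := 0) (b := r) (u := f)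
      (v := fun s => s) (u' := deriv f) (v' := fun _ => 1) hf.continuous.continuousOn
      continuousOn_id (fun s _ => hdf s) (fun s _ => hasDerivAt_id s)
      (hd.intervalIntegrable _ _) (by simp)
    simp only [mul_one] at this
    rw [← this, ← intervalIntegral.integral_sub]
    · refine intervalIntegral.integral_congr fun s _ => ?_
      simp
    · have := hf.continuous
      exact Continuous.intervalIntegrable (by fun_prop) _ _
    · exact hf.continuous.intervalIntegrable _ _
  have h4 : ∫ s in r..T, deriv f s = f T - f r :=
    intervalIntegral.integral_deriv_eq_sub' f rfl
      (fun s _ => hf.differentiable (by simp) s) hd.continuousOn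
  rw [h1, h2, h3, intervalIntegral.integral_mul_const, h4, hfT]
  ring

/-- The Riemann sums only evaluate the path inside `[p,q]`. The σ-algebra is left arbitrary so that
the lemma applies to the one generated by the observed path. -/
theorem measurable_weightedPathIntegral {Ω : Type*} {T : ℝ} {W : ℝ → Ω → ℝ}
    (hW : ∀ ω, Continuous fun s => clampedPath T W s ω) {h : ℝ → ℝ} (hh : Continuous h) {p q : ℝ} (hpq : p ≤ q) {m : MeasurableSpace Ω}
    (hm : ∀ s ∈ Set.Icc p q, Measurable[m] (clampedPath T W s)) :
    Measurable[m] (weightedPathIntegral T W h p q) := by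
  refine measurable_of_tendsto_metrizable (f := fun n ω =>
    leftRiemannSum p q (fun s => h s * clampedPath T W s ω) n) (fun n => ?_)
    (tendsto_pi_nhds.2 fun ω =>
      tendsto_leftRiemannSum (hh.mul (hW ω)) p q)
  refine Finset.measurable_fun_sum _ fun j hj => ?_
  refine ((hm _ ?_).const_mul _).const_mul _
  have hj' : (j : ℝ) ≤ n := by exact_mod_cast Nat.lt_succ_iff.1 (Finset.mem_range.1 hj)
  have hn : (0 : ℝ) < n + 1 := by positivity
  have h0 : 0 ≤ (q - p) / (n + 1 : ℝ) := div_nonneg (sub_nonneg.2 hpq) hn.le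
  have h1 : ((n : ℝ) + 1) * ((q - p) / (n + 1 : ℝ)) = q - p := by field_simp
  constructor
  · have : 0 ≤ (j : ℝ) * ((q - p) / (n + 1 : ℝ)) := by positivity
    linarith
  · nlinarith

namespace IsStandardBrownianMotion

variable {Ω : Type*} [mΩ : MeasurableSpace Ω] {P : Measure Ω} [IsProbabilityMeasure P] {T : ℝ}
  {𝔽 : Filtration (Set.Icc (0 : ℝ) T) mΩ} {W : ℝ → Ω → ℝ}

theorem integral_clamped_mul_clamped (hW : IsStandardBrownianMotion P 𝔽 W)
    {s r : ℝ} (hs : s ∈ Set.Icc 0 T) (hr : r ∈ Set.Icc 0 T) :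
    ∫ ω, clampedPath T W s ω * clampedPath T W r ω ∂P = min s r := by
  rw [clampedPath_of_mem hs, clampedPath_of_mem hr]
  exact hW.integral_eval_mul_eval ⟨s, hs⟩ ⟨r, hr⟩

theorem integral_clamped_sq_le (hW : IsStandardBrownianMotion P 𝔽 W) (hT : 0 ≤ T) (s : ℝ) :
    ∫ ω, clampedPath T W s ω ^ 2 ∂P ≤ T := by
  have := hW.integral_eval_mul_eval (Set.projIcc 0 T hT s) (Set.projIcc 0 T hT s)
  rw [min_self] at this
  have h2 := (Set.projIcc 0 T hT s).2.2
  rw [← this] at h2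
  simp_rw [pow_two]
  exact h2

theorem integral_clamped (hW : IsStandardBrownianMotion P 𝔽 W) (hT : 0 ≤ T) (s : ℝ) :
    ∫ ω, clampedPath T W s ω ∂P = 0 := by
  have := (hW.hasLaw_eval (Set.projIcc 0 T hT s)).integral_eq
  rwa [integral_id_gaussianReal] at this

theorem tendsto_leftRiemannSum_path (hW : IsStandardBrownianMotion P 𝔽 W) (hT : 0 ≤ T)
    {h : ℝ → ℝ} (hh : Continuous h) (p q : ℝ) (ω : Ω) :
    Tendsto (leftRiemannSum p q (fun s => h s * clampedPath T W s ω)) atTop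
      (𝓝 (weightedPathIntegral T W h p q ω)) := by
  have := hW.continuous_clamped hT ω
  exact tendsto_leftRiemannSum (by fun_prop) p q

theorem measurable_pathFunctional (hW : IsStandardBrownianMotion P 𝔽 W) (hT : 0 ≤ T)
    (i : ℝ ⊕ (ℝ × ℝ × C(ℝ, ℝ))) : Measurable (pathFunctional T W i) := by
  rcases i with s | ⟨p, q, h⟩
  · exact hW.measurable_clamped hT s
  · refine measurable_of_tendsto_metrizable (f := fun n ω =>
      leftRiemannSum p q (fun s => h s * clampedPath T W s ω) n) (fun n => ?_)
      (tendsto_pi_nhds.2 fun ω => hW.tendsto_leftRiemannSum_path hT h.continuous p q ω)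
    exact Finset.measurable_fun_sum _ fun j hj =>
      ((hW.measurable_clamped hT _).const_mul _).const_mul _

theorem isGaussianProcess_pathFunctional (hW : IsStandardBrownianMotion P 𝔽 W) (hT : 0 ≤ T) :
    IsGaussianProcess (pathFunctional T W) P := by
  let X : ℕ → ℝ ⊕ (ℝ × ℝ × C(ℝ, ℝ)) → Ω → ℝ := fun n i => match i with
    | Sum.inl s => clampedPath T W s
    | Sum.inr (p, q, h) => fun ω => leftRiemannSum p q (fun s => h s * clampedPath T W s ω) n
  have hspan : ∀ n i, X n i ∈ Submodule.span ℝ (Set.range (clampedPath T W)) := by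
    rintro n (s | ⟨p, q, h⟩)
    · exact Submodule.subset_span ⟨s, rfl⟩
    · have e : X n (Sum.inr (p, q, h)) = ∑ j ∈ Finset.range (n + 1),
          ((q - p) / (n + 1 : ℝ) * h (p + j * ((q - p) / (n + 1 : ℝ)))) •
            clampedPath T W (p + j * ((q - p) / (n + 1 : ℝ))) := by
        funext ω
        simp only [X, leftRiemannSum, Finset.sum_apply, Pi.smul_apply, smul_eq_mul, mul_assoc]
      rw [e]
      exact Submodule.sum_mem _ fun j _ =>
        Submodule.smul_mem _ _ (Submodule.subset_span ⟨_, rfl⟩)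
  refine isGaussianProcess_of_tendsto_ae (X := X)
    (fun n => isGaussianProcess_of_mem_span (hW.isGaussianProcess_clamped hT) (hspan n))
    (fun n i => (integral_eq_zero_of_mem_span
      (fun s => (hW.memLp_clamped hT s).integrable (by norm_num)) (hW.integral_clamped hT)
      (hspan n i)).2)
    (fun i => (hW.measurable_pathFunctional hT i).aemeasurable) ?_
  rintro (s | ⟨p, q, h⟩)
  · exact ae_of_all _ fun ω => tendsto_const_nhds
  · exact ae_of_all _ fun ω => hW.tendsto_leftRiemannSum_path hT h.continuous p q ω

theorem memLp_pathFunctional (hW : IsStandardBrownianMotion P 𝔽 W) (hT : 0 ≤ T)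
    (i : ℝ ⊕ (ℝ × ℝ × C(ℝ, ℝ))) : MemLp (pathFunctional T W i) 2 P :=
  ((hW.isGaussianProcess_pathFunctional hT).hasGaussianLaw_eval i).memLp_two

theorem memLp_weightedPathIntegral (hW : IsStandardBrownianMotion P 𝔽 W) (hT : 0 ≤ T)
    {h : ℝ → ℝ} (hh : Continuous h) (p q : ℝ) : MemLp (weightedPathIntegral T W h p q) 2 P :=
  hW.memLp_pathFunctional hT (Sum.inr (p, q, ⟨h, hh⟩))

/-- Fubini; joint integrability follows from `2 |η W| ≤ η² + W²` and the uniform second moment bound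
`T`. -/
theorem integral_mul_weightedPathIntegral (hW : IsStandardBrownianMotion P 𝔽 W) (hT : 0 ≤ T)
    {h : ℝ → ℝ} (hh : Continuous h) {p q : ℝ} (hpq : p ≤ q) {η : Ω → ℝ} (hη : MemLp η 2 P) :
    ∫ ω, η ω * weightedPathIntegral T W h p q ω ∂P
      = ∫ s in p..q, h s * ∫ ω, η ω * clampedPath T W s ω ∂P := by
  have hB : StronglyMeasurable (Function.uncurry (clampedPath T W)) :=
    stronglyMeasurable_uncurry_of_continuous_of_stronglyMeasurable
      (fun ω => hW.continuous_clamped hT ω)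
      (fun s => (hW.measurable_clamped hT s).stronglyMeasurable)
  have hm : AEStronglyMeasurable
      (Function.uncurry fun s ω => η ω * (h s * clampedPath T W s ω))
      ((volume.restrict (Set.Ioc p q)).prod P) := by
    have h1 : AEStronglyMeasurable (fun x : ℝ × Ω => η x.2)
        ((volume.restrict (Set.Ioc p q)).prod P) := hη.1.comp_snd
    have h2 : StronglyMeasurable (fun x : ℝ × Ω => h x.1 * clampedPath T W x.1 x.2) :=
      (hh.measurable.comp measurable_fst).stronglyMeasurable.mul hB
    exact h1.mul h2.aestronglyMeasurable
  obtain ⟨C, hC⟩ := (isCompact_Icc (a := p) (b := q)).exists_bound_of_continuousOn hh.continuousOn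
  have hηB : ∀ s, Integrable (fun ω => η ω * clampedPath T W s ω) P := fun s =>
    hη.integrable_mul (hW.memLp_clamped hT s)
  have hηsq : Integrable (fun ω => η ω ^ 2) P := hη.integrable_sq
  have hint : Integrable (Function.uncurry fun s ω => η ω * (h s * clampedPath T W s ω))
      ((volume.restrict (Set.Ioc p q)).prod P) := by
    rw [integrable_prod_iff hm]
    constructor
    · refine ae_of_all _ fun s => ?_
      refine ((hηB s).const_mul (h s)).congr (ae_of_all _ fun ω => ?_)
      simp only [Function.uncurry]
      ring
    · refine Integrable.of_bound (hm.norm.integral_prod_right')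
        (C * (((∫ ω, η ω ^ 2 ∂P) + T) / 2)) ?_
      refine (ae_restrict_iff' measurableSet_Ioc).2 (ae_of_all _ fun s hs => ?_)
      have hCs := hC s (Set.Ioc_subset_Icc_self hs)
      have hBsq : Integrable (fun ω => clampedPath T W s ω ^ 2) P :=
        (hW.memLp_clamped hT s).integrable_sq
      rw [Real.norm_eq_abs, abs_of_nonneg (integral_nonneg fun ω => norm_nonneg _)]
      have h1 : ∫ ω, ‖Function.uncurry (fun s ω => η ω * (h s * clampedPath T W s ω)) (s, ω)‖ ∂P
          ≤ ∫ ω, C * ((η ω ^ 2 + clampedPath T W s ω ^ 2) / 2) ∂P := by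
        refine integral_mono_of_nonneg (ae_of_all _ fun ω => norm_nonneg _)
          (((hηsq.add hBsq).div_const 2).const_mul C) (ae_of_all _ fun ω => ?_)
        simp only [Function.uncurry, norm_mul, Real.norm_eq_abs] at hCs ⊢
        have h3 : |η ω| * |clampedPath T W s ω|
            ≤ (η ω ^ 2 + clampedPath T W s ω ^ 2) / 2 := by
          nlinarith [sq_nonneg (|η ω| - |clampedPath T W s ω|), sq_abs (η ω),
            sq_abs (clampedPath T W s ω)]
        calc |η ω| * (|h s| * |clampedPath T W s ω|)
            = |h s| * (|η ω| * |clampedPath T W s ω|) := by ring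
          _ ≤ _ := mul_le_mul hCs h3 (by positivity) ((abs_nonneg _).trans hCs)
      refine h1.trans ?_
      rw [integral_const_mul, integral_div, integral_add hηsq hBsq]
      have hC0 : 0 ≤ C := (norm_nonneg _).trans hCs
      have := hW.integral_clamped_sq_le hT s
      gcongr
  have hswap := integral_integral_swap hint
  simp only [weightedPathIntegral, intervalIntegral.integral_of_le hpq]
  simp_rw [← integral_const_mul]
  rw [← hswap]
  refine integral_congr_ae (ae_of_all _ fun s => ?_)
  refine integral_congr_ae (ae_of_all _ fun ω => ?_)
  ring

theorem integral_weightedPathIntegral (hW : IsStandardBrownianMotion P 𝔽 W) (hT : 0 ≤ T)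
    {h : ℝ → ℝ} (hh : Continuous h) {p q : ℝ} (hpq : p ≤ q) :
    ∫ ω, weightedPathIntegral T W h p q ω ∂P = 0 := by
  have := hW.integral_mul_weightedPathIntegral hT hh hpq (η := fun _ => 1) (memLp_const 1)
  simpa [hW.integral_clamped hT] using this

end IsStandardBrownianMotion

/-! ### The Itô integral of a deterministic smooth integrand. -/

/-- The intervals are disjoint, so the square has no mixed terms. The expanded form is the time side
of the Itô isometry, to be matched term by term with the probabilistic side. -/
theorem setIntegral_stepFunction_sub_sq {n : ℕ} {u : ℕ → ℝ} (hu : Monotone u) {t : ℝ}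
    (h0 : ∀ i, u i ∈ Set.Icc 0 t) (x : ℕ → ℝ) {f : ℝ → ℝ} (hf : Continuous f) :
    IntegrableOn (fun s => (∑ i ∈ Finset.range n,
        (Set.Ioc (u i) (u (i + 1))).indicator (fun _ => x i) s - f s) ^ 2) (Set.Icc 0 t) ∧
    ∫ s in Set.Icc 0 t, (∑ i ∈ Finset.range n,
        (Set.Ioc (u i) (u (i + 1))).indicator (fun _ => x i) s - f s) ^ 2
      = ∑ i ∈ Finset.range n, x i ^ 2 * (u (i + 1) - u i)
        - 2 * ∑ i ∈ Finset.range n, x i * (∫ s in (u i)..(u (i + 1)), f s)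
        + ∫ s in (0 : ℝ)..t, f s ^ 2 := by
  have hdisj : ∀ s, ∀ i ∈ Finset.range n, ∀ j ∈ Finset.range n, j ≠ i →
      (Set.Ioc (u i) (u (i + 1))).indicator (fun _ => x i) s *
        (Set.Ioc (u j) (u (j + 1))).indicator (fun _ => x j) s = 0 := by
    intro s i _ j _ hij
    by_cases h1 : s ∈ Set.Ioc (u i) (u (i + 1))
    · by_cases h2 : s ∈ Set.Ioc (u j) (u (j + 1))
      · exact absurd h2 (Set.disjoint_left.1
          (hu.pairwise_disjoint_on_Ioc_succ hij.symm) h1)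
      · rw [Set.indicator_of_notMem h2, mul_zero]
    · rw [Set.indicator_of_notMem h1, zero_mul]
  have hpt : ∀ s, (∑ i ∈ Finset.range n,
        (Set.Ioc (u i) (u (i + 1))).indicator (fun _ => x i) s - f s) ^ 2
      = ∑ i ∈ Finset.range n,
          (Set.Ioc (u i) (u (i + 1))).indicator (fun s => x i ^ 2 - 2 * (x i * f s)) s
        + f s ^ 2 := by
    intro s
    have h1 : (∑ i ∈ Finset.range n,
        (Set.Ioc (u i) (u (i + 1))).indicator (fun _ => x i) s) ^ 2
        = ∑ i ∈ Finset.range n, (Set.Ioc (u i) (u (i + 1))).indicator (fun _ => x i ^ 2) s := by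
      rw [pow_two, Finset.sum_mul_sum]
      refine Finset.sum_congr rfl fun i hi => ?_
      rw [Finset.sum_eq_single_of_mem i hi (hdisj s i hi)]
      by_cases h : s ∈ Set.Ioc (u i) (u (i + 1)) <;> simp [h, pow_two]
    rw [sub_sq, h1, Finset.mul_sum, Finset.sum_mul, ← Finset.sum_sub_distrib]
    congr 1
    refine Finset.sum_congr rfl fun i _ => ?_
    by_cases h : s ∈ Set.Ioc (u i) (u (i + 1)) <;> simp [h, mul_assoc]
  have hsub : ∀ i, Set.Ioc (u i) (u (i + 1)) ⊆ Set.Icc 0 t := fun i s hs =>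
    ⟨(h0 i).1.trans hs.1.le, hs.2.trans (h0 (i + 1)).2⟩
  have hI1 : ∀ i, IntegrableOn
      ((Set.Ioc (u i) (u (i + 1))).indicator (fun s => x i ^ 2 - 2 * (x i * f s)))
      (Set.Icc 0 t) := fun i =>
    IntegrableOn.indicator (Continuous.integrableOn_Icc (by fun_prop)) measurableSet_Ioc
  have hI2 : IntegrableOn (fun s => f s ^ 2) (Set.Icc 0 t) :=
    Continuous.integrableOn_Icc (by fun_prop)
  simp_rw [hpt]
  refine ⟨(integrable_finsetSum _ fun i _ => hI1 i).add hI2, ?_⟩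
  have ht : 0 ≤ t := (h0 0).1.trans (h0 0).2
  rw [integral_add (integrable_finsetSum _ fun i _ => hI1 i) hI2,
    integral_finsetSum _ fun i _ => hI1 i]
  congr 1
  · rw [Finset.mul_sum, ← Finset.sum_sub_distrib]
    refine Finset.sum_congr rfl fun i _ => ?_
    rw [setIntegral_indicator measurableSet_Ioc, Set.inter_eq_right.2 (hsub i),
      ← intervalIntegral.integral_of_le (hu (Nat.le_succ i)), intervalIntegral.integral_sub,
      intervalIntegral.integral_const, intervalIntegral.integral_const_mul,
      intervalIntegral.integral_const_mul, smul_eq_mul, mul_comm (x i ^ 2)]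
    · simp
    · exact Continuous.intervalIntegrable (by fun_prop) _ _
  · rw [intervalIntegral.integral_of_le ht, integral_Icc_eq_integral_Ioc]

namespace IsStandardBrownianMotion

variable {Ω : Type*} [mΩ : MeasurableSpace Ω] {P : Measure Ω} [IsProbabilityMeasure P] {T : ℝ}
  {𝔽 : Filtration (Set.Icc (0 : ℝ) T) mΩ} {W : ℝ → Ω → ℝ}

/-- `-∫_0^T f'(s) W_s ds` is the Wiener integral of `f` if `f(T) = 0`. -/
theorem integral_clamped_mul_wienerIntegral (hW : IsStandardBrownianMotion P 𝔽 W) (hT : 0 ≤ T)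
    {f : ℝ → ℝ} (hf : ContDiff ℝ (⊤ : ℕ∞) f) (hfT : f T = 0) {r : ℝ} (hr : r ∈ Set.Icc 0 T) :
    ∫ ω, clampedPath T W r ω * weightedPathIntegral T W (deriv f) 0 T ω ∂P
      = -∫ s in (0 : ℝ)..r, f s := by
  rw [hW.integral_mul_weightedPathIntegral hT (hf.continuous_deriv (by simp)) hT
    (hW.memLp_clamped hT r), ← integral_deriv_mul_min hf hr hfT]
  refine intervalIntegral.integral_congr fun s hs => ?_
  rw [Set.uIcc_of_le hT] at hs
  rw [hW.integral_clamped_mul_clamped hr hs, min_comm]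

/-- Insert the covariance with `W s` under the time integral and integrate by parts against the
primitive of `f`; both boundary terms vanish, since `f T = 0` and the primitive starts at `0`. -/
theorem integral_wienerIntegral_sq (hW : IsStandardBrownianMotion P 𝔽 W) (hT : 0 ≤ T)
    {f : ℝ → ℝ} (hf : ContDiff ℝ (⊤ : ℕ∞) f) (hfT : f T = 0) :
    ∫ ω, weightedPathIntegral T W (deriv f) 0 T ω ^ 2 ∂P = ∫ s in (0 : ℝ)..T, f s ^ 2 := by
  have hd : Continuous (deriv f) := hf.continuous_deriv (by simp)
  have hc : Continuous f := hf.continuous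
  simp_rw [pow_two]
  rw [hW.integral_mul_weightedPathIntegral hT hd hT (hW.memLp_weightedPathIntegral hT hd 0 T)]
  have h1 : ∫ s in (0 : ℝ)..T, deriv f s *
        ∫ ω, weightedPathIntegral T W (deriv f) 0 T ω * clampedPath T W s ω ∂P
      = -∫ s in (0 : ℝ)..T, deriv f s * ∫ r in (0 : ℝ)..s, f r := by
    rw [← intervalIntegral.integral_neg]
    refine intervalIntegral.integral_congr fun s hs => ?_
    rw [Set.uIcc_of_le hT] at hs
    simp_rw [mul_comm (weightedPathIntegral T W (deriv f) 0 T _)]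
    rw [hW.integral_clamped_mul_wienerIntegral hT hf hfT hs]
    ring
  have h2 := intervalIntegral.integral_mul_deriv_eq_deriv_mul (a := 0) (b := T)
    (u := fun s => ∫ r in (0 : ℝ)..s, f r) (v := f) (u' := f) (v' := deriv f)
    (fun s _ => hc.integral_hasStrictDerivAt 0 s |>.hasDerivAt)
    (fun s _ => (hf.differentiable (by simp) s).hasDerivAt)
    (hc.intervalIntegrable _ _) (hd.intervalIntegrable _ _)
  rw [hfT, intervalIntegral.integral_same, mul_zero, zero_mul, sub_zero, zero_sub] at h2
  simp_rw [mul_comm (deriv f _)] at h1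
  simp_rw [mul_comm (deriv f _)]
  rw [h1, h2, neg_neg]

theorem memLp_mul_increment (hW : IsStandardBrownianMotion P 𝔽 W) (s t : Set.Icc (0 : ℝ) T)
    {ξ : Ω → ℝ} (hξ : Measurable ξ) {C : ℝ} (hC : ∀ ω, |ξ ω| ≤ C) :
    MemLp (fun ω => ξ ω * (W t ω - W s ω)) 2 P := by
  have := (hW.memLp_increment s t).mul' (p := ⊤) (r := 2)
    (memLp_top_of_bound hξ.aestronglyMeasurable C (ae_of_all _ hC))
  exact this

/-- The mixed term of the Itô isometry. The minus sign appears because `∫ f' W` is the negative of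
the Wiener integral of `f`. -/
theorem integral_mul_increment_mul_wienerIntegral (hW : IsStandardBrownianMotion P 𝔽 W)
    (hT : 0 ≤ T) {f : ℝ → ℝ} (hf : ContDiff ℝ (⊤ : ℕ∞) f) (hfT : f T = 0)
    {s t : Set.Icc (0 : ℝ) T} (hst : s ≤ t) {ξ : Ω → ℝ} (hξ : Measurable[𝔽 s] ξ) {C : ℝ}
    (hC : ∀ ω, |ξ ω| ≤ C) :
    ∫ ω, ξ ω * (W t ω - W s ω) * weightedPathIntegral T W (deriv f) 0 T ω ∂P
      = -(∫ ω, ξ ω ∂P) * ∫ r in (s : ℝ)..t, f r := by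
  have hd : Continuous (deriv f) := hf.continuous_deriv (by simp)
  rw [hW.integral_mul_weightedPathIntegral hT hd hT
    (hW.memLp_mul_increment s t (hξ.mono (𝔽.le s) le_rfl) hC)]
  have h1 : ∀ r ∈ Set.uIcc 0 T, deriv f r *
        ∫ ω, ξ ω * (W t ω - W s ω) * clampedPath T W r ω ∂P
      = (∫ ω, ξ ω ∂P) * (deriv f r * min r t - deriv f r * min r s) := by
    intro r hr
    rw [Set.uIcc_of_le hT] at hr
    rw [clampedPath_of_mem hr]
    rw [hW.integral_mul_increment_mul_eval hst ⟨r, hr⟩ hξ hC, min_comm r, min_comm r]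
    ring
  rw [intervalIntegral.integral_congr h1, intervalIntegral.integral_const_mul,
    intervalIntegral.integral_sub (Continuous.intervalIntegrable (by fun_prop) _ _)
      (Continuous.intervalIntegrable (by fun_prop) _ _),
    integral_deriv_mul_min hf t.2 hfT, integral_deriv_mul_min hf s.2 hfT]
  have h2 := intervalIntegral.integral_interval_sub_left (a := 0) (b := (t : ℝ)) (c := (s : ℝ))
    (μ := volume) (hf.continuous.intervalIntegrable _ _) (hf.continuous.intervalIntegrable _ _)
  rw [← h2]
  ring

/-- The Itô isometry for the difference of a simple process and a Wiener integral. -/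
theorem integral_simple_sub_wienerIntegral_sq (hW : IsStandardBrownianMotion P 𝔽 W)
    (hT : 0 ≤ T) {f : ℝ → ℝ} (hf : ContDiff ℝ (⊤ : ℕ∞) f) (hfT : f T = 0)
    (n : ℕ) {u : ℕ → Set.Icc (0 : ℝ) T} (hu : Monotone u) {ξ : ℕ → Ω → ℝ}
    (hξ : ∀ i, Measurable[𝔽 (u i)] (ξ i)) (hC : ∀ i, ∃ C, ∀ ω, |ξ i ω| ≤ C) :
    Integrable (fun ω => (∑ i ∈ Finset.range n, ξ i ω * (W (u (i + 1)) ω - W (u i) ω)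
        + weightedPathIntegral T W (deriv f) 0 T ω) ^ 2) P ∧
    ∫ ω, (∑ i ∈ Finset.range n, ξ i ω * (W (u (i + 1)) ω - W (u i) ω)
        + weightedPathIntegral T W (deriv f) 0 T ω) ^ 2 ∂P
      = ∑ i ∈ Finset.range n, (∫ ω, ξ i ω ^ 2 ∂P) * ((u (i + 1) : ℝ) - u i)
        - 2 * ∑ i ∈ Finset.range n, (∫ ω, ξ i ω ∂P) * (∫ s in (u i : ℝ)..(u (i + 1)), f s)
        + ∫ s in (0 : ℝ)..T, f s ^ 2 := by
  choose C hC using hC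
  have hd : Continuous (deriv f) := hf.continuous_deriv (by simp)
  set M : ℕ → Ω → ℝ := fun i ω => ξ i ω * (W (u (i + 1)) ω - W (u i) ω) with hM
  set X := weightedPathIntegral T W (deriv f) 0 T with hX
  have hle : ∀ i, u i ≤ u (i + 1) := fun i => hu (Nat.le_succ i)
  have hML : ∀ i, MemLp (M i) 2 P := fun i =>
    hW.memLp_mul_increment (u i) (u (i + 1)) ((hξ i).mono (𝔽.le _) le_rfl) (hC i)
  have hXL : MemLp X 2 P := hW.memLp_weightedPathIntegral hT hd 0 T
  -- For `i < j` the product of `M i` and `ξ j` is already known at time `u j`, so the later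
  -- increment averages it to zero.
  have hlt : ∀ i j, i < j → ∫ ω, M i ω * M j ω ∂P = 0 := by
    intro i j hij
    have hm : Measurable[𝔽 (u j)] (fun ω => M i ω * ξ j ω) := by
      refine Measurable.mul (Measurable.mul ((hξ i).mono (𝔽.mono (hu hij.le)) le_rfl) ?_) (hξ j)
      exact (hW.measurable_of_le (hu hij)).sub (hW.measurable_of_le (hu hij.le))
    have := hW.integral_mul_increment (hle j) hm
    rw [← this]
    refine integral_congr_ae (ae_of_all _ fun ω => ?_)
    simp only [hM]; ring
  have hdiag : ∀ i, ∫ ω, M i ω * M i ω ∂P = (∫ ω, ξ i ω ^ 2 ∂P) * ((u (i + 1) : ℝ) - u i) := by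
    intro i
    rw [← hW.integral_mul_increment_sq (hle i) ((hξ i).pow_const 2)]
    refine integral_congr_ae (ae_of_all _ fun ω => ?_)
    simp only [hM]; ring
  have hpt : ∀ ω, (∑ i ∈ Finset.range n, M i ω + X ω) ^ 2
      = ∑ i ∈ Finset.range n, ∑ j ∈ Finset.range n, M i ω * M j ω
        + 2 * ∑ i ∈ Finset.range n, M i ω * X ω + X ω ^ 2 := by
    intro ω
    rw [add_sq, pow_two (∑ i ∈ Finset.range n, M i ω), Finset.sum_mul_sum, mul_assoc,
      Finset.sum_mul]
  have hMM : ∀ i j, Integrable (fun ω => M i ω * M j ω) P := fun i j =>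
    (hML i).integrable_mul (hML j)
  have hMX : ∀ i, Integrable (fun ω => M i ω * X ω) P := fun i =>
    (hML i).integrable_mul hXL
  have i1 : Integrable (fun ω => ∑ i ∈ Finset.range n, ∑ j ∈ Finset.range n, M i ω * M j ω) P :=
    integrable_finsetSum _ fun i _ => integrable_finsetSum _ fun j _ => hMM i j
  have i2 : Integrable (fun ω => 2 * ∑ i ∈ Finset.range n, M i ω * X ω) P :=
    (integrable_finsetSum _ fun i _ => hMX i).const_mul 2
  have i3 : Integrable (fun ω => X ω ^ 2) P := hXL.integrable_sq
  change Integrable (fun ω => (∑ i ∈ Finset.range n, M i ω + X ω) ^ 2) P ∧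
    ∫ ω, (∑ i ∈ Finset.range n, M i ω + X ω) ^ 2 ∂P = _
  simp_rw [hpt]
  refine ⟨(i1.add i2).add i3, ?_⟩
  refine (integral_add (i1.add i2) i3).trans ?_
  rw [integral_add' i1 i2, hX,
    hW.integral_wienerIntegral_sq hT hf hfT, ← hX, integral_const_mul,
    integral_finsetSum _ fun i _ => hMX i,
    integral_finsetSum _ fun i _ => integrable_finsetSum _ fun j _ => hMM i j]
  congr 1
  rw [sub_eq_add_neg]
  congr 1
  · refine Finset.sum_congr rfl fun i hi => ?_
    rw [integral_finsetSum _ fun j _ => hMM i j, Finset.sum_eq_single_of_mem i hi, hdiag]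
    intro j _ hji
    rcases lt_or_gt_of_ne hji with h | h
    · rw [← hlt j i h]
      exact integral_congr_ae (ae_of_all _ fun ω => mul_comm _ _)
    · exact hlt i j h
  · rw [← mul_neg, ← Finset.sum_neg_distrib]
    congr 1
    refine Finset.sum_congr rfl fun i _ => ?_
    rw [← neg_mul]
    exact hW.integral_mul_increment_mul_wienerIntegral hT hf hfT (hle i) (hξ i) (hC i)


/-- After truncating the partition at `t`, both sides expand to the same quadratic expression in the
coefficients. This is where the defining convergence of the integrands in `L²` passes to the
stochastic integrals. -/
theorem lintegral_simpleIntegral_add_wienerIntegral (hW : IsStandardBrownianMotion P 𝔽 W)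
    (hT : 0 ≤ T) {f : ℝ → ℝ} (hf : ContDiff ℝ (⊤ : ℕ∞) f) {t : ℝ} (ht : t ∈ Set.Icc 0 T)
    (hft : ∀ s, t ≤ s → f s = 0) (S : SimpleIntegrand 𝔽) :
    ∫⁻ ω, ENNReal.ofReal (|S.integral W t ω + weightedPathIntegral T W (deriv f) 0 T ω| ^ 2) ∂P
      = ∫⁻ ω, ∫⁻ s in Set.Icc 0 t, ENNReal.ofReal (|S.eval s ω - f s| ^ 2) ∂volume ∂P := by
  classical
  have hfT : f T = 0 := hft T ht.2
  set t' : Set.Icc (0 : ℝ) T := ⟨t, ht⟩ with ht'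
  set u : ℕ → Set.Icc (0 : ℝ) T := fun i => min (S.time i) t' with hu
  have hcoe : ∀ i, (u i : ℝ) = min (S.time i : ℝ) t := by
    intro i
    rcases le_total (S.time i) t' with h | h
    · rw [hu]; simp only [min_eq_left h]; rw [min_eq_left (show (S.time i : ℝ) ≤ t from h)]
    · rw [hu]; simp only [min_eq_right h]; rw [min_eq_right (show t ≤ (S.time i : ℝ) from h)]
  have humono : Monotone u := fun i j hij => min_le_min_right _ (S.time_mono hij)
  have hut : ∀ i, (u i : ℝ) ∈ Set.Icc 0 t := fun i => ⟨(u i).2.1, by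
    rw [hcoe]; exact min_le_right _ _⟩
  -- A coefficient belonging to a time after `t` need not be measurable at the truncated time `u i =
  -- t`. It is replaced by zero, which changes nothing because its truncated increment vanishes.
  set ξ : ℕ → Ω → ℝ := fun i => if S.time i ≤ t' then S.coef i else fun _ => 0 with hξ
  have hξm : ∀ i, Measurable[𝔽 (u i)] (ξ i) := by
    intro i
    by_cases h : S.time i ≤ t'
    · have h1 : u i = S.time i := min_eq_left h
      simp only [hξ, if_pos h]
      rw [h1]
      exact S.coef_measurable i
    · simp only [hξ, if_neg h]
      exact measurable_const
  have hξb : ∀ i, ∃ C, ∀ ω, |ξ i ω| ≤ C := by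
    intro i
    by_cases h : S.time i ≤ t'
    · simp only [hξ, if_pos h]
      exact S.coef_bounded i
    · exact ⟨0, by simp [hξ, if_neg h]⟩
  have hint : ∀ ω, S.integral W t ω
      = ∑ i ∈ Finset.range S.n, ξ i ω * (W (u (i + 1)) ω - W (u i) ω) := by
    intro ω
    refine Finset.sum_congr rfl fun i _ => ?_
    rw [hcoe, hcoe]
    by_cases h : S.time i ≤ t'
    · simp only [hξ, if_pos h]
    · have h1 : t ≤ S.time i := (not_le.1 h).le
      have h2 : t ≤ S.time (i + 1) := h1.trans (S.time_mono (Nat.le_succ i))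
      rw [min_eq_right h1, min_eq_right h2, sub_self, mul_zero, mul_zero]
  have heval : ∀ ω, ∀ s ∈ Set.Icc 0 t, S.eval s ω
      = ∑ i ∈ Finset.range S.n,
        (Set.Ioc (u i : ℝ) (u (i + 1))).indicator (fun _ => ξ i ω) s := by
    intro ω s hs
    refine Finset.sum_congr rfl fun i _ => ?_
    rw [hcoe, hcoe]
    by_cases h : S.time i ≤ t'
    · simp only [hξ, if_pos h]
      have : s ∈ Set.Ioc (S.time i : ℝ) (S.time (i + 1)) ↔
          s ∈ Set.Ioc (min (S.time i : ℝ) t) (min (S.time (i + 1) : ℝ) t) := by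
        rw [min_eq_left (show (S.time i : ℝ) ≤ t from h), Set.mem_Ioc, Set.mem_Ioc, le_min_iff]
        exact ⟨fun h => ⟨h.1, h.2, hs.2⟩, fun h => ⟨h.1, h.2.1⟩⟩
      by_cases hm : s ∈ Set.Ioc (S.time i : ℝ) (S.time (i + 1))
      · rw [Set.indicator_of_mem hm, Set.indicator_of_mem (this.1 hm)]
      · rw [Set.indicator_of_notMem hm, Set.indicator_of_notMem fun h => hm (this.2 h)]
    · have h1 : t < S.time i := not_le.1 h
      rw [Set.indicator_of_notMem fun hm => (hm.1.trans_le hs.2).not_gt h1]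
      simp [hξ, if_neg h]
  obtain ⟨hI, hE⟩ := hW.integral_simple_sub_wienerIntegral_sq hT hf hfT S.n humono hξm hξb
  have hdet := fun ω => setIntegral_stepFunction_sub_sq (n := S.n) (u := fun i => (u i : ℝ))
    (fun i j hij => humono hij) hut (fun i => ξ i ω) hf.continuous
  have hfin : ∫ s in (0 : ℝ)..t, f s ^ 2 = ∫ s in (0 : ℝ)..T, f s ^ 2 := by
    have hi : ∀ p q, IntervalIntegrable (fun s => f s ^ 2) volume p q := fun p q =>
      (hf.continuous.pow 2).intervalIntegrable _ _
    rw [← intervalIntegral.integral_add_adjacent_intervals (hi 0 t) (hi t T)]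
    have : ∫ s in t..T, f s ^ 2 = ∫ s in t..T, (0 : ℝ) := by
      refine intervalIntegral.integral_congr fun s hs => ?_
      rw [Set.uIcc_of_le ht.2] at hs
      simp [hft s hs.1]
    rw [this]
    simp
  have hinner : ∀ ω, ∫⁻ s in Set.Icc 0 t, ENNReal.ofReal (|S.eval s ω - f s| ^ 2)
      = ENNReal.ofReal (∑ i ∈ Finset.range S.n, ξ i ω ^ 2 * ((u (i + 1) : ℝ) - u i)
        - 2 * ∑ i ∈ Finset.range S.n, ξ i ω * (∫ s in (u i : ℝ)..(u (i + 1)), f s)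
        + ∫ s in (0 : ℝ)..t, f s ^ 2) := by
    intro ω
    rw [← (hdet ω).2, ofReal_integral_eq_lintegral_ofReal (hdet ω).1
      (ae_of_all _ fun s => sq_nonneg _)]
    refine setLIntegral_congr_fun measurableSet_Icc fun s hs => ?_
    simp only [sq_abs]
    rw [heval ω s hs]
  have hξi : ∀ i, Integrable (ξ i) P := fun i => by
    obtain ⟨C, hC⟩ := hξb i
    exact Integrable.of_bound ((hξm i).mono (𝔽.le _) le_rfl).aestronglyMeasurable C
      (ae_of_all _ hC)
  have hξi2 : ∀ i, Integrable (fun ω => ξ i ω ^ 2) P := fun i => by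
    obtain ⟨C, hC⟩ := hξb i
    refine Integrable.of_bound
      (((hξm i).mono (𝔽.le _) le_rfl).pow_const 2).aestronglyMeasurable (C ^ 2)
      (ae_of_all _ fun ω => ?_)
    rw [norm_pow]
    exact pow_le_pow_left₀ (norm_nonneg _) (hC ω) 2
  simp_rw [hinner, sq_abs, hint]
  rw [← ofReal_integral_eq_lintegral_ofReal hI (ae_of_all _ fun ω => sq_nonneg _), hE]
  have j1 : Integrable (fun ω => ∑ i ∈ Finset.range S.n, ξ i ω ^ 2 * ((u (i + 1) : ℝ) - u i)) P :=
    integrable_finsetSum _ fun i _ => (hξi2 i).mul_const _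
  have j2 : Integrable (fun ω => 2 * ∑ i ∈ Finset.range S.n,
      ξ i ω * (∫ s in (u i : ℝ)..(u (i + 1)), f s)) P :=
    (integrable_finsetSum _ fun i _ => (hξi i).mul_const _).const_mul 2
  have j3 := (j1.sub j2).add (integrable_const (∫ s in (0 : ℝ)..t, f s ^ 2))
  have hpos : 0 ≤ᵐ[P] (fun ω => ∑ i ∈ Finset.range S.n, ξ i ω ^ 2 * ((u (i + 1) : ℝ) - u i))
      - (fun ω => 2 * ∑ i ∈ Finset.range S.n, ξ i ω * (∫ s in (u i : ℝ)..(u (i + 1)), f s))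
      + fun _ => ∫ s in (0 : ℝ)..t, f s ^ 2 := ae_of_all _ fun ω => by
    simp only [Pi.zero_apply, Pi.add_apply, Pi.sub_apply]
    rw [← (hdet ω).2]
    exact integral_nonneg fun s => sq_nonneg _
  refine Eq.trans ?_ (ofReal_integral_eq_lintegral_ofReal j3 hpos)
  congr 1
  refine Eq.trans ?_ (integral_add' (j1.sub j2) (integrable_const _)).symm
  rw [integral_sub' j1 j2, integral_const_mul,
    integral_finsetSum _ fun i _ => (hξi2 i).mul_const _,
    integral_finsetSum _ fun i _ => (hξi i).mul_const _, hfin]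
  simp [integral_mul_const]

/-- The Itô integral of a deterministic smooth integrand vanishing after time `t`. -/
theorem ae_eq_of_isItoIntegral (hW : IsStandardBrownianMotion P 𝔽 W)
    (hT : 0 ≤ T) {f : ℝ → ℝ} (hf : ContDiff ℝ (⊤ : ℕ∞) f) {t : ℝ} (ht : t ∈ Set.Icc 0 T)
    (hft : ∀ s, t ≤ s → f s = 0) {H : ℝ → Ω → ℝ} {I : Ω → ℝ}
    (hH : ∀ᵐ ω ∂P, ∀ s ∈ Set.Icc 0 t, H s ω = f s) (hI : IsItoIntegral P 𝔽 W H t I) :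
    I =ᵐ[P] fun ω => -weightedPathIntegral T W (deriv f) 0 T ω := by
  obtain ⟨-, hIm, S, hS, hSI⟩ := hI
  set X := weightedPathIntegral T W (deriv f) 0 T with hX
  have hXm : Measurable X := measurable_weightedPathIntegral (hW.continuous_clamped hT)
    (hf.continuous_deriv (by simp)) hT fun s _ => hW.measurable_clamped hT s
  have h1 : Tendsto (fun k => ∫⁻ ω, ENNReal.ofReal (|(S k).integral W t ω + X ω| ^ 2) ∂P)
      atTop (𝓝 0) := by
    refine hS.congr fun k => ?_
    rw [hX, hW.lintegral_simpleIntegral_add_wienerIntegral hT hf ht hft]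
    refine lintegral_congr_ae ?_
    filter_upwards [hH] with ω hω
    exact setLIntegral_congr_fun measurableSet_Icc fun s hs => by rw [hω s hs]
  have hSm : ∀ k, Measurable ((S k).integral W t) := by
    intro k
    refine Finset.measurable_fun_sum _ fun i _ => ?_
    refine (((S k).coef_measurable i).mono (𝔽.le _) le_rfl).mul ?_
    have hmem : ∀ i, min ((S k).time i : ℝ) t ∈ Set.Icc 0 T := fun i =>
      ⟨le_min ((S k).time i).2.1 ht.1, (min_le_right _ _).trans ht.2⟩
    exact (hW.measurable ⟨_, hmem (i + 1)⟩).sub (hW.measurable ⟨_, hmem i⟩)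
  -- `I + X` is the difference of `S + X` and `S - I`, both of which tend to zero in `L²`; hence `I
  -- = -X` almost surely.
  have hle : ∀ k, ∫⁻ ω, ENNReal.ofReal (|I ω + X ω| ^ 2) ∂P
      ≤ 2 * (∫⁻ ω, ENNReal.ofReal (|(S k).integral W t ω + X ω| ^ 2) ∂P
        + ∫⁻ ω, ENNReal.ofReal (|(S k).integral W t ω - I ω| ^ 2) ∂P) := by
    intro k
    have hm : Measurable fun ω => ENNReal.ofReal (|(S k).integral W t ω + X ω| ^ 2) :=
      ((continuous_abs.measurable.comp ((hSm k).add hXm)).pow_const 2).ennreal_ofReal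
    rw [← lintegral_add_left hm, ← lintegral_const_mul' _ _ (by simp)]
    refine lintegral_mono fun ω => ?_
    rw [← ENNReal.ofReal_add (by positivity) (by positivity),
      show (2 : ℝ≥0∞) = ENNReal.ofReal 2 by simp, ← ENNReal.ofReal_mul (by norm_num)]
    refine ENNReal.ofReal_le_ofReal ?_
    simp only [sq_abs]
    nlinarith [sq_nonneg (((S k).integral W t ω + X ω) + ((S k).integral W t ω - I ω))]
  have hzero : ∫⁻ ω, ENNReal.ofReal (|I ω + X ω| ^ 2) ∂P = 0 := by
    refine le_antisymm (ge_of_tendsto' (x := atTop) ?_ hle) zero_le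
    have := ENNReal.Tendsto.const_mul (a := 2) (h1.add hSI) (Or.inr (by simp))
    simpa using this
  rw [lintegral_eq_zero_iff'] at hzero
  · filter_upwards [hzero] with ω hω
    have h2 : |I ω + X ω| ^ 2 ≤ 0 := ENNReal.ofReal_eq_zero.1 hω
    rw [sq_abs] at h2
    have h3 : I ω + X ω = 0 := by
      have := le_antisymm h2 (sq_nonneg _)
      exact pow_eq_zero_iff (two_ne_zero) |>.1 this
    linarith
  · exact ((continuous_abs.measurable.comp_aemeasurable
      (hIm.add hXm.aemeasurable)).pow_const 2).ennreal_ofReal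

end IsStandardBrownianMotion

/-! ### Pathwise analysis of the drift equation. -/

/-- One null set suffices for the countably many rational times, projected to `[p,q]`; continuity
covers the others. -/
theorem ae_forall_eq_of_continuousOn {Ω : Type*} {mΩ : MeasurableSpace Ω} {P : Measure Ω}
    {p q : ℝ} (hpq : p ≤ q) {F G : ℝ → Ω → ℝ}
    (hF : ∀ ω, ContinuousOn (fun t => F t ω) (Set.Icc p q))
    (hG : ∀ ω, ContinuousOn (fun t => G t ω) (Set.Icc p q))
    (h : ∀ t ∈ Set.Icc p q, ∀ᵐ ω ∂P, F t ω = G t ω) :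
    ∀ᵐ ω ∂P, ∀ t ∈ Set.Icc p q, F t ω = G t ω := by
  have hae : ∀ᵐ ω ∂P, ∀ r : ℚ, F (Set.projIcc p q hpq r) ω = G (Set.projIcc p q hpq r) ω :=
    ae_all_iff.2 fun r => h _ (Set.projIcc p q hpq r).2
  filter_upwards [hae] with ω hω t ht
  have hc : ∀ {K : ℝ → Ω → ℝ}, ContinuousOn (fun t => K t ω) (Set.Icc p q) →
      Continuous fun s : ℝ => K (Set.projIcc p q hpq s) ω := fun hK =>
    hK.comp_continuous (continuous_subtype_val.comp continuous_projIcc)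
      fun s => (Set.projIcc p q hpq s).2
  have := (Rat.denseRange_cast (𝕜 := ℝ)).equalizer (hc (hF ω)) (hc (hG ω)) (funext hω)
  have h2 := congrFun this t
  simpa only [Set.projIcc_of_mem hpq ht] using h2

section DriftEquation

variable {T τ₁ τ₂ : ℝ} {g k x : ℝ → ℝ}

theorem monotoneOn_of_drift_equation (hg : Continuous g) (hg0 : ∀ y, 0 ≤ g y)
    (hk : Continuous k) (hk0 : ∀ s, 0 ≤ k s) (hx : Continuous x)
    (heq : ∀ t ∈ Set.Icc 0 T, x t = t + ∫ s in (0 : ℝ)..t, g (x s) * k s) {s t : ℝ}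
    (hs : 0 ≤ s) (hst : s ≤ t) (ht : t ≤ T) : x s + (t - s) ≤ x t := by
  have hi : ∀ a b, IntervalIntegrable (fun s => g (x s) * k s) volume a b := fun a b =>
    Continuous.intervalIntegrable (by fun_prop) _ _
  rw [heq s ⟨hs, hst.trans ht⟩, heq t ⟨hs.trans hst, ht⟩,
    ← intervalIntegral.integral_add_adjacent_intervals (hi 0 s) (hi s t)]
  have : 0 ≤ ∫ s in s..t, g (x s) * k s :=
    intervalIntegral.integral_nonneg hst fun r _ => mul_nonneg (hg0 _) (hk0 _)
  linarith

theorem le_of_drift_equation (hg : Continuous g) (hg0 : ∀ y, 0 ≤ g y)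
    (hk : Continuous k) (hk0 : ∀ s, 0 ≤ k s) (hx : Continuous x)
    (heq : ∀ t ∈ Set.Icc 0 T, x t = t + ∫ s in (0 : ℝ)..t, g (x s) * k s) {t : ℝ}
    (ht : t ∈ Set.Icc 0 T) : t ≤ x t := by
  have h0 : x 0 = 0 := by simpa using heq 0 ⟨le_rfl, ht.1.trans ht.2⟩
  have := monotoneOn_of_drift_equation hg hg0 hk hk0 hx heq le_rfl ht.1 ht.2
  linarith

/-- The path increases, so as long as it is at most `τ₁` it has only met zeros of `g` and has moved
at unit speed. Being above `τ₁` too early would require crossing that level at a time `s ≤ t`, but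
then `s = τ₁ ≥ t`. -/
theorem eq_self_of_drift_equation (hg : Continuous g) (hg0 : ∀ y, 0 ≤ g y)
    (hk : Continuous k) (hk0 : ∀ s, 0 ≤ k s) (hx : Continuous x) (hgz : ∀ y, y ≤ τ₁ → g y = 0)
    (heq : ∀ t ∈ Set.Icc 0 T, x t = t + ∫ s in (0 : ℝ)..t, g (x s) * k s) {t : ℝ}
    (ht : t ∈ Set.Icc 0 T) (htτ : t ≤ τ₁) : x t = t := by
  have key : ∀ r ∈ Set.Icc 0 T, x r ≤ τ₁ → x r = r := by
    intro r hr hxr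
    rw [heq r hr]
    have : ∫ s in (0 : ℝ)..r, g (x s) * k s = ∫ s in (0 : ℝ)..r, (0 : ℝ) := by
      refine intervalIntegral.integral_congr fun s hs => ?_
      rw [Set.uIcc_of_le hr.1] at hs
      have := monotoneOn_of_drift_equation hg hg0 hk hk0 hx heq hs.1 hs.2 hr.2
      have h2 := hs.2
      change g (x s) * k s = 0
      rw [hgz (x s) (by linarith), zero_mul]
    rw [this]
    simp
  refine key t ht ?_
  by_contra! hlt
  have h0 : x 0 = 0 := by simpa using heq 0 ⟨le_rfl, ht.1.trans ht.2⟩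
  obtain ⟨s, hs, hxs⟩ := intermediate_value_Icc ht.1 hx.continuousOn
    (show τ₁ ∈ Set.Icc (x 0) (x t) from ⟨by rw [h0]; exact ht.1.trans htτ, hlt.le⟩)
  have h1 := key s ⟨hs.1, hs.2.trans ht.2⟩ hxs.le
  have h2 : s = t := le_antisymm hs.2 (by linarith)
  rw [← h2, hxs] at hlt
  exact lt_irrefl _ hlt

/-- The time which the solution of `x' = 1 + γ g(x)` needs to get from `τ₁` to `τ₂`. -/
noncomputable def crossingTime (g : ℝ → ℝ) (τ₁ τ₂ γ : ℝ) : ℝ :=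
  ∫ z in τ₁..τ₂, (1 + max γ 0 * g z)⁻¹

/-- The value at time `T` of the solution of `x' = 1 + γ g(x)` started in `τ₁` at time `τ₁`, for
functions `g` which are equal to `4` from `τ₂` on. -/
noncomputable def terminalValue (g : ℝ → ℝ) (τ₁ τ₂ T γ : ℝ) : ℝ :=
  τ₂ + (1 + 4 * γ) * (T - τ₁ - crossingTime g τ₁ τ₂ γ)

theorem continuous_inv_one_add_mul (hg : Continuous g) (hg0 : ∀ y, 0 ≤ g y) {γ : ℝ}
    (hγ : 0 ≤ γ) : Continuous fun z => (1 + γ * g z)⁻¹ :=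
  Continuous.inv₀ (by fun_prop) fun z => by have := mul_nonneg hγ (hg0 z); positivity

/-- A larger drift crosses faster. The truncation `max γ 0` keeps the denominator at least one for
every real `γ`, so monotonicity, and with it measurability, holds on the whole line. -/
theorem crossingTime_antitone (hg : Continuous g) (hg0 : ∀ y, 0 ≤ g y) (h : τ₁ ≤ τ₂) :
    Antitone (crossingTime g τ₁ τ₂) := by
  intro γ₁ γ₂ hγ
  refine intervalIntegral.integral_mono_on h
    ((continuous_inv_one_add_mul hg hg0 (le_max_right _ _)).intervalIntegrable _ _)
    ((continuous_inv_one_add_mul hg hg0 (le_max_right _ _)).intervalIntegrable _ _) fun z _ => ?_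
  have h1 : max γ₁ 0 * g z ≤ max γ₂ 0 * g z :=
    mul_le_mul_of_nonneg_right (max_le_max_right 0 hγ) (hg0 z)
  have h2 : 0 ≤ max γ₁ 0 * g z := mul_nonneg (le_max_right _ _) (hg0 z)
  gcongr

theorem crossingTime_le (hg : Continuous g) (hg0 : ∀ y, 0 ≤ g y) (h : τ₁ ≤ τ₂) (γ : ℝ) :
    crossingTime g τ₁ τ₂ γ ≤ τ₂ - τ₁ := by
  have := intervalIntegral.integral_mono_on h
    ((continuous_inv_one_add_mul hg hg0 (le_max_right γ 0)).intervalIntegrable _ _)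
    (intervalIntegrable_const (μ := volume) (c := (1 : ℝ))) fun z _ => inv_le_one_of_one_le₀ (by
      have := mul_nonneg (le_max_right γ 0) (hg0 z)
      linarith)
  simpa [crossingTime] using this

theorem measurable_terminalValue (hg : Continuous g) (hg0 : ∀ y, 0 ≤ g y) (h : τ₁ ≤ τ₂) :
    Measurable (terminalValue g τ₁ τ₂ T) := by
  have := (crossingTime_antitone hg hg0 h).measurable
  unfold terminalValue
  fun_prop

/-- Write `c₁`, `c₂` for the two crossing times. The difference is `4 (γ₁ - γ₂) (T - τ₁ - c₁) + (1 +
4 γ₂) (c₂ - c₁)`. The last term is nonnegative by monotonicity, and `c₁ ≤ τ₂ - τ₁` leaves at least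
the time `T - τ₂` at full speed. -/
theorem le_terminalValue_sub (hg : Continuous g) (hg0 : ∀ y, 0 ≤ g y) (h : τ₁ ≤ τ₂) {γ₁ γ₂ : ℝ}
    (h2 : 0 ≤ γ₂) (h21 : γ₂ ≤ γ₁) :
    4 * (γ₁ - γ₂) * (T - τ₂) ≤ terminalValue g τ₁ τ₂ T γ₁ - terminalValue g τ₁ τ₂ T γ₂ := by
  have h3 := crossingTime_antitone hg hg0 h h21
  have h4 := crossingTime_le hg hg0 h γ₁
  unfold terminalValue
  nlinarith [mul_nonneg (sub_nonneg.2 h21) (sub_nonneg.2 h4), mul_nonneg h2 (sub_nonneg.2 h3)]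

theorem le_abs_terminalValue_sub (hg : Continuous g) (hg0 : ∀ y, 0 ≤ g y) (h : τ₁ ≤ τ₂)
    {γ₁ γ₂ : ℝ} (h1 : 0 ≤ γ₁) (h2 : 0 ≤ γ₂) :
    4 * (T - τ₂) * |γ₁ - γ₂|
      ≤ |terminalValue g τ₁ τ₂ T γ₁ - terminalValue g τ₁ τ₂ T γ₂| := by
  rcases le_total γ₂ γ₁ with h21 | h12
  · have := le_terminalValue_sub (T := T) hg hg0 h h2 h21
    rw [abs_of_nonneg (sub_nonneg.2 h21)]
    refine le_trans ?_ (le_abs_self _)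
    linarith
  · have := le_terminalValue_sub (T := T) hg hg0 h h1 h12
    rw [abs_sub_comm, abs_of_nonneg (sub_nonneg.2 h12), abs_sub_comm]
    refine le_trans ?_ (le_abs_self _)
    linarith

/-- Separation of variables: the primitive of `1 / (1 + γ g)` along the path grows at unit rate.
Beyond `τ₂` the integrand is the constant `1 / (1 + 4 γ)`, so the resulting identity can be solved
for `x T`. -/
theorem eq_terminalValue_of_drift_equation (hg : Continuous g) (hg0 : ∀ y, 0 ≤ g y)
    (hk : Continuous k) (hk0 : ∀ s, 0 ≤ k s) (hx : Continuous x) (hgz : ∀ y, y ≤ τ₁ → g y = 0)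
    (hg4 : ∀ y, τ₂ ≤ y → g y = 4) (hτ₁ : 0 ≤ τ₁) (hτ₁T : τ₁ ≤ T) (hτ₂T : τ₂ ≤ T)
    (heq : ∀ t ∈ Set.Icc 0 T, x t = t + ∫ s in (0 : ℝ)..t, g (x s) * k s) {γ : ℝ} (hγ : 0 ≤ γ)
    (hkγ : ∀ s ∈ Set.Icc τ₁ T, k s = γ) :
    x T = terminalValue g τ₁ τ₂ T γ := by
  have hxτ : x τ₁ = τ₁ :=
    eq_self_of_drift_equation hg hg0 hk hk0 hx hgz heq ⟨hτ₁, hτ₁T⟩ le_rfl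
  have hxT : T ≤ x T := le_of_drift_equation hg hg0 hk hk0 hx heq ⟨hτ₁.trans hτ₁T, le_rfl⟩
  have hpos : ∀ y, 0 < 1 + γ * g y := fun y => by
    have := mul_nonneg hγ (hg0 y)
    positivity
  have hΦc := continuous_inv_one_add_mul hg hg0 hγ
  -- `x` is only known to solve the equation on `[0,T]`; `F` agrees with it on `[τ₁,T]` and is
  -- differentiable everywhere, endpoints included.
  set F : ℝ → ℝ := fun t => τ₁ + ∫ s in τ₁..t, (1 + γ * g (x s)) with hF
  have hFx : ∀ t ∈ Set.Icc τ₁ T, F t = x t := by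
    intro t ht
    have hi : ∀ a b, IntervalIntegrable (fun s => g (x s) * k s) volume a b := fun a b =>
      Continuous.intervalIntegrable (by fun_prop) _ _
    have h1 := heq t ⟨hτ₁.trans ht.1, ht.2⟩
    have h2 := heq τ₁ ⟨hτ₁, hτ₁T⟩
    rw [← intervalIntegral.integral_add_adjacent_intervals (hi 0 τ₁) (hi τ₁ t)] at h1
    have h3 : ∫ s in τ₁..t, g (x s) * k s = ∫ s in τ₁..t, γ * g (x s) := by
      refine intervalIntegral.integral_congr fun s hs => ?_
      rw [Set.uIcc_of_le ht.1] at hs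
      simp only [hkγ s ⟨hs.1, hs.2.trans ht.2⟩]
      ring
    rw [h3] at h1
    simp only [hF]
    rw [intervalIntegral.integral_add (by simp) (Continuous.intervalIntegrable (by fun_prop) _ _),
      intervalIntegral.integral_const, smul_eq_mul]
    linarith
  have hder : ∀ t ∈ Set.uIcc τ₁ T,
      HasDerivAt (fun t => ∫ z in τ₁..F t, (1 + γ * g z)⁻¹) 1 t := by
    intro t ht
    rw [Set.uIcc_of_le hτ₁T] at ht
    have hFd : HasDerivAt F (1 + γ * g (x t)) t := by
      have hc : Continuous fun s => 1 + γ * g (x s) := by fun_prop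
      exact ((hc.integral_hasStrictDerivAt τ₁ t).hasDerivAt).const_add τ₁
    have := (hΦc.integral_hasStrictDerivAt τ₁ (F t)).hasDerivAt.comp t hFd
    rw [hFx t ht, inv_mul_cancel₀ (hpos _).ne'] at this
    exact this
  have hint := intervalIntegral.integral_eq_sub_of_hasDerivAt hder (by simp)
  rw [hFx T ⟨hτ₁T, le_rfl⟩, hFx τ₁ ⟨le_rfl, hτ₁T⟩, hxτ, intervalIntegral.integral_same, sub_zero,
    intervalIntegral.integral_const, smul_eq_mul, mul_one,
    ← intervalIntegral.integral_add_adjacent_intervals (hΦc.intervalIntegrable τ₁ τ₂)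
      (hΦc.intervalIntegrable τ₂ (x T))] at hint
  have hlast : ∫ z in τ₂..x T, (1 + γ * g z)⁻¹ = (x T - τ₂) * (1 + 4 * γ)⁻¹ := by
    rw [← smul_eq_mul, ← intervalIntegral.integral_const]
    refine intervalIntegral.integral_congr fun z hz => ?_
    rw [Set.uIcc_of_le (hτ₂T.trans hxT)] at hz
    simp only [hg4 z hz.1, mul_comm γ 4]
  rw [hlast] at hint
  have h4 : (1 + 4 * γ) ≠ 0 := by positivity
  unfold terminalValue crossingTime
  rw [max_eq_left hγ, hint]
  field_simp
  ring

end DriftEquation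

/-! ### The terminal value as a function of the Wiener integral. -/

section PathwiseSolution

variable {T τ₁ τ₂ : ℝ} {f g ψ : ℝ → ℝ} {Ω : Type*} [mΩ : MeasurableSpace Ω] {P : Measure Ω}
  [IsProbabilityMeasure P] {𝔽 : Filtration (Set.Icc (0 : ℝ) T) mΩ} {W X₁ X₂ : ℝ → Ω → ℝ}

theorem ContinuousOn.continuous_clampedPath {Y : ℝ → Ω → ℝ} {ω : Ω} (hT : 0 ≤ T)
    (hY : ContinuousOn (fun t => Y t ω) (Set.Icc 0 T)) :
    Continuous fun s => clampedPath T Y s ω :=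
  hY.comp_continuous (by fun_prop) (fun s => (Set.projIcc 0 T hT s).2)

theorem ae_forall_drift_equation (hT : 0 ≤ T) (hg : Continuous g) (hψ : Continuous ψ)
    (hX₁ : ∀ ω, ContinuousOn (fun t => X₁ t ω) (Set.Icc 0 T))
    (hX₂ : ∀ ω, ContinuousOn (fun t => X₂ t ω) (Set.Icc 0 T))
    (hX₂_eq : ∀ t ∈ Set.Icc 0 T, ∀ᵐ ω ∂P,
      X₂ t ω = t + ∫ s in (0 : ℝ)..t, g (X₂ s ω) * (Real.cos (ψ (X₁ s ω)) + 1)) :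
    ∀ᵐ ω ∂P, ∀ t ∈ Set.Icc 0 T, clampedPath T X₂ t ω
      = t + ∫ s in (0 : ℝ)..t, g (clampedPath T X₂ s ω) *
        (Real.cos (ψ (clampedPath T X₁ s ω)) + 1) := by
  have h1 := fun ω => (hX₁ ω).continuous_clampedPath hT
  have h2 := fun ω => (hX₂ ω).continuous_clampedPath hT
  refine ae_forall_eq_of_continuousOn hT (fun ω => (h2 ω).continuousOn) (fun ω => ?_) ?_
  · have hc : Continuous fun s => g (clampedPath T X₂ s ω) *
        (Real.cos (ψ (clampedPath T X₁ s ω)) + 1) := by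
      have := h1 ω
      have := h2 ω
      fun_prop
    exact (continuous_id.add (intervalIntegral.continuous_primitive
      (fun a b => hc.intervalIntegrable a b) 0)).continuousOn
  · intro t ht
    filter_upwards [hX₂_eq t ht] with ω hω
    rw [clampedPath_of_mem ht, hω]
    congr 1
    refine intervalIntegral.integral_congr fun s hs => ?_
    rw [Set.uIcc_of_le ht.1] at hs
    have hs' : s ∈ Set.Icc 0 T := ⟨hs.1, hs.2.trans ht.2⟩
    simp only [clampedPath_of_mem hs']

theorem ae_terminal_eq (hT : 0 ≤ T) (hτ₁ : 0 ≤ τ₁) (hτ₁T : τ₁ ≤ T)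
    (hτ₂T : τ₂ ≤ T) (hf : ContDiff ℝ (⊤ : ℕ∞) f) (hf_zero : ∀ x, τ₁ ≤ x → f x = 0)
    (hg : Continuous g) (hg0 : ∀ y, 0 ≤ g y) (hg_zero : ∀ x, x ≤ τ₁ → g x = 0)
    (hg_four : ∀ x, τ₂ ≤ x → g x = 4) (hW : IsStandardBrownianMotion P 𝔽 W)
    (hψ : Continuous ψ) (hX₁ : IsContinuousAdapted 𝔽 X₁) (hX₂ : IsContinuousAdapted 𝔽 X₂)
    (hX₁_eq : ∀ t ∈ Set.Icc 0 T, IsItoIntegral P 𝔽 W (fun s ω => f (X₂ s ω)) t (X₁ t))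
    (hX₂_eq : ∀ t ∈ Set.Icc 0 T, ∀ᵐ ω ∂P,
      X₂ t ω = t + ∫ s in (0 : ℝ)..t, g (X₂ s ω) * (Real.cos (ψ (X₁ s ω)) + 1)) :
    ∀ᵐ ω ∂P, X₂ T ω = terminalValue g τ₁ τ₂ T
      (Real.cos (ψ (-weightedPathIntegral T W (deriv f) 0 T ω)) + 1) := by
  have hdrift := ae_forall_drift_equation hT hg hψ hX₁.continuousOn hX₂.continuousOn hX₂_eq
  have c1 := fun ω => (hX₁.continuousOn ω).continuous_clampedPath hT
  have c2 := fun ω => (hX₂.continuousOn ω).continuous_clampedPath hT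
  have hk : ∀ ω, Continuous fun s => Real.cos (ψ (clampedPath T X₁ s ω)) + 1 := fun ω => by
    have := c1 ω
    fun_prop
  have hk0 : ∀ ω s, 0 ≤ Real.cos (ψ (clampedPath T X₁ s ω)) + 1 := fun ω s => by
    have := Real.neg_one_le_cos (ψ (clampedPath T X₁ s ω))
    linarith
  -- Before `τ₁` the process equals time; after `τ₁` it stays beyond `τ₁`, where both values of `f`
  -- vanish.
  have hfX : ∀ᵐ ω ∂P, ∀ s ∈ Set.Icc 0 T, f (X₂ s ω) = f s := by
    filter_upwards [hdrift] with ω hω s hs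
    rw [← clampedPath_of_mem (W := X₂) hs]
    rcases le_total s τ₁ with h | h
    · rw [eq_self_of_drift_equation hg hg0 (hk ω) (hk0 ω) (c2 ω) hg_zero hω hs h]
    · have := le_of_drift_equation hg hg0 (hk ω) (hk0 ω) (c2 ω) hω hs
      rw [hf_zero s h, hf_zero _ (h.trans this)]
  have hX₁c : ∀ᵐ ω ∂P, ∀ t ∈ Set.Icc τ₁ T,
      X₁ t ω = -weightedPathIntegral T W (deriv f) 0 T ω := by
    refine ae_forall_eq_of_continuousOn hτ₁T
      (G := fun _ ω => -weightedPathIntegral T W (deriv f) 0 T ω)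
      (fun ω => (hX₁.continuousOn ω).mono (Set.Icc_subset_Icc_left hτ₁))
      (fun ω => continuousOn_const) fun t ht => ?_
    have htT : t ∈ Set.Icc 0 T := ⟨hτ₁.trans ht.1, ht.2⟩
    refine hW.ae_eq_of_isItoIntegral hT hf htT (fun s hs => hf_zero s (ht.1.trans hs)) ?_
      (hX₁_eq t htT)
    filter_upwards [hfX] with ω hω s hs using hω s ⟨hs.1, hs.2.trans ht.2⟩
  filter_upwards [hdrift, hX₁c] with ω hω hω₁
  rw [← clampedPath_of_mem (W := X₂) (Set.right_mem_Icc.2 hT)]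
  have hT' := hω₁ T ⟨hτ₁T, le_rfl⟩
  refine eq_terminalValue_of_drift_equation hg hg0 (hk ω) (hk0 ω) (c2 ω) hg_zero hg_four hτ₁
    hτ₁T hτ₂T hω ?_ fun s hs => ?_
  · have := Real.neg_one_le_cos (ψ (-weightedPathIntegral T W (deriv f) 0 T ω))
    linarith
  · rw [clampedPath_of_mem ⟨hτ₁.trans hs.1, hs.2⟩, hω₁ s hs]

end PathwiseSolution

/-! ### Borel measurability of the observed path. -/

/-- Evaluations generate the Borel sets of the space of continuous functions on a compact
space. -/
theorem ContinuousMap.measurable_borel_of_eval {Ω K : Type*} {m : MeasurableSpace Ω}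
    [TopologicalSpace K] [CompactSpace K] [SecondCountableTopology K] [LocallyCompactSpace K]
    {Φ : Ω → C(K, ℝ)} (h : ∀ s, Measurable fun ω => Φ ω s) :
    @Measurable _ _ m (borel C(K, ℝ)) Φ := by
  obtain ⟨D, hDc, hDd⟩ := TopologicalSpace.exists_countable_dense K
  -- By continuity a sup-norm bound need only be checked on a countable dense set of points.
  have hball : ∀ (x : C(K, ℝ)) (r : ℝ), 0 ≤ r → MeasurableSet (Φ ⁻¹' Metric.closedBall x r) := by
    intro x r hr
    have : Φ ⁻¹' Metric.closedBall x r = ⋂ s ∈ D, {ω | dist (Φ ω s) (x s) ≤ r} := by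
      ext ω
      simp only [Set.mem_preimage, Metric.mem_closedBall, Set.mem_iInter, Set.mem_ofPred_eq]
      rw [ContinuousMap.dist_le hr]
      refine ⟨fun h s _ => h s, fun h s => ?_⟩
      have hcl : IsClosed {s | dist (Φ ω s) (x s) ≤ r} :=
        isClosed_le (by fun_prop) continuous_const
      exact hcl.closure_subset_iff.2 (fun s hs => h s hs) (hDd s)
    rw [this]
    exact MeasurableSet.biInter hDc fun s _ =>
      measurableSet_le ((h s).dist measurable_const) measurable_const
  -- The Lindelöf property of `C(K, ℝ)` makes every open set a countable union of closed balls.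
  have hopen : ∀ U : Set C(K, ℝ), IsOpen U → MeasurableSet (Φ ⁻¹' U) := by
    intro U hU
    have hr : ∀ x : U, ∃ r > 0, Metric.closedBall (x : C(K, ℝ)) r ⊆ U := fun x =>
      Metric.nhds_basis_closedBall.mem_iff.1 (hU.mem_nhds x.2)
    choose r hr0 hrU using hr
    obtain ⟨S, hSc, hS⟩ := TopologicalSpace.isOpen_iUnion_countable
      (fun x : U => Metric.ball (x : C(K, ℝ)) (r x)) fun x => Metric.isOpen_ball
    have hU' : U = ⋃ x ∈ S, Metric.closedBall (x : C(K, ℝ)) (r x) := by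
      refine Set.Subset.antisymm (fun y hy => ?_) (Set.iUnion₂_subset fun x _ => hrU x)
      have : y ∈ ⋃ x ∈ S, Metric.ball (x : C(K, ℝ)) (r x) := by
        rw [hS]
        exact Set.mem_iUnion.2 ⟨⟨y, hy⟩, Metric.mem_ball_self (hr0 _)⟩
      exact Set.iUnion₂_mono (fun x _ => Metric.ball_subset_closedBall) this
    rw [hU', Set.preimage_iUnion₂]
    exact MeasurableSet.biUnion hSc fun x _ => hball _ _ (hr0 x).le
  exact measurable_generateFrom hopen

/-! ### The Brownian bridge on `[a,b]` and the splitting of the Wiener integral. -/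

section BridgeKernel

/-- The covariance of `W_t` with the deviation of `W_r` from the linear interpolation of `W`
between the times `a` and `b`. -/
noncomputable def bridgeKernel (a b t r : ℝ) : ℝ :=
  min r t - (b - r) / (b - a) * min a t - (r - a) / (b - a) * min b t

@[fun_prop]
theorem continuous_bridgeKernel (a b t : ℝ) : Continuous (bridgeKernel a b t) := by
  unfold bridgeKernel
  fun_prop

variable {a b : ℝ}

/-- Outside the gap, `r ↦ min r t` is affine over the relevant range of `r` and coincides with its
interpolation; this is why the bridge is uncorrelated with the observations. -/
theorem bridgeKernel_of_le (hab : a < b) {t r : ℝ} (ht : t ≤ a) (hr : a ≤ r) :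
    bridgeKernel a b t r = 0 := by
  have : b - a ≠ 0 := (sub_pos.2 hab).ne'
  rw [bridgeKernel, min_eq_right (ht.trans hr), min_eq_right ht, min_eq_right (ht.trans hab.le)]
  field_simp
  ring

theorem bridgeKernel_of_ge (hab : a < b) {t r : ℝ} (ht : b ≤ t) (hr : r ≤ b) :
    bridgeKernel a b t r = 0 := by
  have : b - a ≠ 0 := (sub_pos.2 hab).ne'
  rw [bridgeKernel, min_eq_left (hr.trans ht), min_eq_left ht, min_eq_left (hab.le.trans ht)]
  field_simp
  ring

/-- Inside the gap this is the bridge covariance `(min r t - a) (b - max r t) / (b - a)`. Its sign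
allows the variance to be bounded through pointwise bounds on the weight. -/
theorem bridgeKernel_nonneg (hab : a < b) {t r : ℝ} (ht : t ∈ Set.Icc a b)
    (hr : r ∈ Set.Icc a b) : 0 ≤ bridgeKernel a b t r := by
  have h : 0 < b - a := sub_pos.2 hab
  rw [bridgeKernel, min_eq_left ht.1, min_eq_right ht.2]
  rcases le_total r t with hrt | htr
  · rw [min_eq_left hrt, show r - (b - r) / (b - a) * a - (r - a) / (b - a) * t
      = (r - a) * (b - t) / (b - a) by field_simp; ring]
    exact div_nonneg (mul_nonneg (sub_nonneg.2 hr.1) (sub_nonneg.2 ht.2)) h.le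
  · rw [min_eq_right htr, show t - (b - r) / (b - a) * a - (r - a) / (b - a) * t
      = (t - a) * (b - r) / (b - a) by field_simp; ring]
    exact div_nonneg (mul_nonneg (sub_nonneg.2 ht.1) (sub_nonneg.2 hr.2)) h.le

theorem integral_bridgeKernel (hab : a < b) {t : ℝ} (ht : t ∈ Set.Icc a b) :
    ∫ r in a..b, bridgeKernel a b t r = (t - a) * (b - t) / 2 := by
  have h : b - a ≠ 0 := (sub_pos.2 hab).ne'
  have e1 : ∫ r in a..t, bridgeKernel a b t r
      = ∫ r in a..t, (b - t) / (b - a) * (r - a) := by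
    refine intervalIntegral.integral_congr fun r hr => ?_
    rw [Set.uIcc_of_le ht.1] at hr
    simp only [bridgeKernel]
    rw [min_eq_left hr.2, min_eq_left ht.1, min_eq_right ht.2]
    field_simp
    ring
  have e2 : ∫ r in t..b, bridgeKernel a b t r
      = ∫ r in t..b, (t - a) / (b - a) * (b - r) := by
    refine intervalIntegral.integral_congr fun r hr => ?_
    rw [Set.uIcc_of_le ht.2] at hr
    simp only [bridgeKernel]
    rw [min_eq_right hr.1, min_eq_left ht.1, min_eq_right ht.2]
    field_simp
    ring
  rw [← intervalIntegral.integral_add_adjacent_intervals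
    ((continuous_bridgeKernel a b t).intervalIntegrable a t)
    ((continuous_bridgeKernel a b t).intervalIntegrable t b), e1, e2,
    intervalIntegral.integral_const_mul, intervalIntegral.integral_const_mul,
    intervalIntegral.integral_sub (by simp) (by simp),
    intervalIntegral.integral_sub (by simp) (by simp), integral_id, integral_id,
    intervalIntegral.integral_const, intervalIntegral.integral_const]
  simp only [smul_eq_mul]
  field_simp
  ring

theorem integral_sub_mul_sub_half (a b : ℝ) :
    ∫ t in a..b, (t - a) * (b - t) / 2 = (b - a) ^ 3 / 12 := by
  have hder : ∀ t ∈ Set.uIcc a b, HasDerivAt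
      (fun t => (b - a) * (t - a) ^ 2 / 4 - (t - a) ^ 3 / 6) ((t - a) * (b - t) / 2) t := by
    intro t _
    have h1 : HasDerivAt (fun t => t - a) 1 t := (hasDerivAt_id t).sub_const a
    have := (((h1.pow 2).const_mul (b - a)).div_const 4).sub ((h1.pow 3).div_const 6)
    refine this.congr_deriv ?_
    simp
    ring
  rw [intervalIntegral.integral_eq_sub_of_hasDerivAt hder
    (Continuous.intervalIntegrable (by fun_prop) _ _)]
  ring

end BridgeKernel

/-- The integral over `[a,b]` of the deviation of `W` from its linear interpolation between `a`
and `b`, with weight `h`. -/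
noncomputable def bridgeIntegral {Ω : Type*} (T : ℝ) (W : ℝ → Ω → ℝ) (h : ℝ → ℝ) (a b : ℝ)
    (ω : Ω) : ℝ :=
  weightedPathIntegral T W h a b ω
    - (∫ r in a..b, h r * ((b - r) / (b - a))) * clampedPath T W a ω
    - (∫ r in a..b, h r * ((r - a) / (b - a))) * clampedPath T W b ω

theorem integral_sub_mul_sub_mul {Ω : Type*} {mΩ : MeasurableSpace Ω} {P : Measure Ω}
    {u v w : Ω → ℝ} (hu : Integrable u P) (hv : Integrable v P) (hw : Integrable w P) (c d : ℝ) :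
    ∫ ω, (u ω - c * v ω - d * w ω) ∂P
      = ∫ ω, u ω ∂P - c * ∫ ω, v ω ∂P - d * ∫ ω, w ω ∂P := by
  refine (integral_sub (hu.sub (hv.const_mul c)) (hw.const_mul d)).trans ?_
  rw [integral_const_mul, integral_sub' hu (hv.const_mul c), integral_const_mul]

namespace IsStandardBrownianMotion

variable {Ω : Type*} [mΩ : MeasurableSpace Ω] {P : Measure Ω} [IsProbabilityMeasure P] {T : ℝ}
  {𝔽 : Filtration (Set.Icc (0 : ℝ) T) mΩ} {W : ℝ → Ω → ℝ} {h : ℝ → ℝ} {a b : ℝ}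

theorem bridgeIntegral_mem_span (hh : Continuous h) (T : ℝ) (W : ℝ → Ω → ℝ) (a b : ℝ) :
    bridgeIntegral T W h a b ∈ Submodule.span ℝ (Set.range (pathFunctional T W)) := by
  have e : bridgeIntegral T W h a b = pathFunctional T W (Sum.inr (a, b, ⟨h, hh⟩))
      - (∫ r in a..b, h r * ((b - r) / (b - a))) • pathFunctional T W (Sum.inl a)
      - (∫ r in a..b, h r * ((r - a) / (b - a))) • pathFunctional T W (Sum.inl b) := rfl
  rw [e]
  have hs := fun i => Submodule.subset_span (R := ℝ) (Set.mem_range_self (f := pathFunctional T W) i)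
  exact Submodule.sub_mem _ (Submodule.sub_mem _ (hs _) (Submodule.smul_mem _ _ (hs _)))
    (Submodule.smul_mem _ _ (hs _))

theorem hasGaussianLaw_of_mem_span (hW : IsStandardBrownianMotion P 𝔽 W) (hT : 0 ≤ T)
    {Y : Ω → ℝ} (hY : Y ∈ Submodule.span ℝ (Set.range (pathFunctional T W))) :
    HasGaussianLaw Y P :=
  (isGaussianProcess_of_mem_span (hW.isGaussianProcess_pathFunctional hT)
    (Y := fun _ : Unit => Y) fun _ => hY).hasGaussianLaw_eval ()

theorem memLp_bridgeIntegral (hW : IsStandardBrownianMotion P 𝔽 W) (hT : 0 ≤ T)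
    (hh : Continuous h) (a b : ℝ) : MemLp (bridgeIntegral T W h a b) 2 P :=
  (hW.hasGaussianLaw_of_mem_span hT (bridgeIntegral_mem_span hh T W a b)).memLp_two

theorem measurable_bridgeIntegral (hW : IsStandardBrownianMotion P 𝔽 W) (hT : 0 ≤ T)
    (hh : Continuous h) (hab : a ≤ b) : Measurable (bridgeIntegral T W h a b) := by
  have h1 := measurable_weightedPathIntegral (hW.continuous_clamped hT) hh hab
    fun s _ => hW.measurable_clamped hT s
  exact (h1.sub ((hW.measurable_clamped hT a).const_mul _)).sub
    ((hW.measurable_clamped hT b).const_mul _)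

theorem integral_bridgeIntegral (hW : IsStandardBrownianMotion P 𝔽 W) (hT : 0 ≤ T)
    (hh : Continuous h) (hab : a ≤ b) : ∫ ω, bridgeIntegral T W h a b ω ∂P = 0 := by
  have i1 : Integrable (weightedPathIntegral T W h a b) P :=
    (hW.memLp_weightedPathIntegral hT hh a b).integrable (by norm_num)
  have i2 : ∀ s, Integrable (clampedPath T W s) P := fun s =>
    (hW.memLp_clamped hT s).integrable (by norm_num)
  unfold bridgeIntegral
  rw [integral_sub_mul_sub_mul i1 (i2 _) (i2 _), hW.integral_clamped hT, hW.integral_clamped hT,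
    hW.integral_weightedPathIntegral hT hh hab]
  simp

theorem integral_clamped_mul_bridgeIntegral (hW : IsStandardBrownianMotion P 𝔽 W)
    (hh : Continuous h) (ha : 0 ≤ a) (hab : a ≤ b) (hb : b ≤ T) {t : ℝ} (ht : t ∈ Set.Icc 0 T) :
    ∫ ω, clampedPath T W t ω * bridgeIntegral T W h a b ω ∂P
      = ∫ r in a..b, h r * bridgeKernel a b t r := by
  have hT : 0 ≤ T := ha.trans (hab.trans hb)
  have ht2 := hW.memLp_clamped hT t
  have e : ∀ ω, clampedPath T W t ω * bridgeIntegral T W h a b ω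
      = clampedPath T W t ω * weightedPathIntegral T W h a b ω
        - (∫ r in a..b, h r * ((b - r) / (b - a))) *
          (clampedPath T W t ω * clampedPath T W a ω)
        - (∫ r in a..b, h r * ((r - a) / (b - a))) *
          (clampedPath T W t ω * clampedPath T W b ω) := by
    intro ω
    unfold bridgeIntegral
    ring
  have i1 : Integrable (fun ω => clampedPath T W t ω * weightedPathIntegral T W h a b ω) P :=
    ht2.integrable_mul (hW.memLp_weightedPathIntegral hT hh a b)
  have i2 : ∀ s, Integrable (fun ω => clampedPath T W t ω * clampedPath T W s ω) P :=
    fun s => ht2.integrable_mul (hW.memLp_clamped hT s)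
  simp_rw [e]
  rw [integral_sub_mul_sub_mul i1 (i2 _) (i2 _), hW.integral_mul_weightedPathIntegral hT hh hab ht2,
    hW.integral_clamped_mul_clamped ht ⟨ha, hab.trans hb⟩,
    hW.integral_clamped_mul_clamped ht ⟨ha.trans hab, hb⟩,
    ← intervalIntegral.integral_mul_const, ← intervalIntegral.integral_mul_const]
  have h1 : ∫ s in a..b, h s * ∫ ω, clampedPath T W t ω * clampedPath T W s ω ∂P
      = ∫ s in a..b, h s * min s t := by
    refine intervalIntegral.integral_congr fun s hs => ?_
    rw [Set.uIcc_of_le hab] at hs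
    have := hW.integral_clamped_mul_clamped ht ⟨ha.trans hs.1, hs.2.trans hb⟩
    simp only [this, min_comm]
  rw [h1, ← intervalIntegral.integral_sub, ← intervalIntegral.integral_sub]
  · refine intervalIntegral.integral_congr fun s _ => ?_
    simp only [bridgeKernel]
    rw [min_comm t a, min_comm t b]
    ring
  all_goals exact Continuous.intervalIntegrable (by fun_prop) _ _

theorem integral_clamped_mul_bridgeIntegral_eq_zero (hW : IsStandardBrownianMotion P 𝔽 W)
    (hh : Continuous h) (ha : 0 ≤ a) (hab : a < b) (hb : b ≤ T) {t : ℝ}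
    (ht : t ∈ observedTimes a b T) :
    ∫ ω, clampedPath T W t ω * bridgeIntegral T W h a b ω ∂P = 0 := by
  rw [hW.integral_clamped_mul_bridgeIntegral hh ha hab.le hb
    (observedTimes_subset (ha.trans hab.le) (hab.le.trans hb) ht)]
  have : ∫ r in a..b, h r * bridgeKernel a b t r = ∫ r in a..b, (0 : ℝ) := by
    refine intervalIntegral.integral_congr fun r hr => ?_
    rw [Set.uIcc_of_le hab.le] at hr
    rcases ht with ht | ht
    · simp only [bridgeKernel_of_le hab ht.2 hr.1, mul_zero]
    · simp only [bridgeKernel_of_ge hab ht.1 hr.2, mul_zero]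
  rw [this]
  simp

/-- The bridge integral is orthogonal to `W a` and `W b`, so one factor of the square may be
replaced by its plain weighted integral. -/
theorem integral_bridgeIntegral_sq (hW : IsStandardBrownianMotion P 𝔽 W)
    (hh : Continuous h) (ha : 0 ≤ a) (hab : a < b) (hb : b ≤ T) :
    ∫ ω, bridgeIntegral T W h a b ω ^ 2 ∂P
      = ∫ t in a..b, h t * ∫ r in a..b, h r * bridgeKernel a b t r := by
  have hT : 0 ≤ T := ha.trans (hab.le.trans hb)
  have hV := hW.memLp_bridgeIntegral hT hh a b
  set V := bridgeIntegral T W h a b with hVdef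
  have e : ∀ ω, V ω ^ 2 = V ω * weightedPathIntegral T W h a b ω
        - (∫ r in a..b, h r * ((b - r) / (b - a))) * (clampedPath T W a ω * V ω)
        - (∫ r in a..b, h r * ((r - a) / (b - a))) * (clampedPath T W b ω * V ω) := by
    intro ω
    rw [pow_two]
    conv_lhs => rw [hVdef]
    conv_lhs => arg 1; unfold bridgeIntegral
    rw [← hVdef]
    ring
  have i1 : Integrable (fun ω => V ω * weightedPathIntegral T W h a b ω) P :=
    hV.integrable_mul (hW.memLp_weightedPathIntegral hT hh a b)
  have i2 : ∀ s, Integrable (fun ω => clampedPath T W s ω * V ω) P := fun s =>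
    (hW.memLp_clamped hT s).integrable_mul hV
  simp_rw [e]
  rw [integral_sub_mul_sub_mul i1 (i2 _) (i2 _),
    hW.integral_clamped_mul_bridgeIntegral_eq_zero hh ha hab hb (Or.inl ⟨ha, le_rfl⟩),
    hW.integral_clamped_mul_bridgeIntegral_eq_zero hh ha hab hb (Or.inr ⟨le_rfl, hb⟩),
    hW.integral_mul_weightedPathIntegral hT hh hab.le hV, mul_zero, mul_zero, sub_zero, sub_zero]
  refine intervalIntegral.integral_congr fun t ht => ?_
  rw [Set.uIcc_of_le hab.le] at ht
  rw [← hW.integral_clamped_mul_bridgeIntegral hh ha hab.le hb ⟨ha.trans ht.1, ht.2.trans hb⟩]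
  simp_rw [mul_comm (V _)]
  rfl

/-- The variance of the integrated deviation from linear interpolation, for weights between
`-2` and `-1`. -/
theorem integral_bridgeIntegral_sq_mem (hW : IsStandardBrownianMotion P 𝔽 W)
    (hh : Continuous h) (ha : 0 ≤ a) (hab : a < b) (hb : b ≤ T)
    (hbd : ∀ s ∈ Set.Icc a b, h s ∈ Set.Icc (-2) (-1)) :
    ∫ ω, bridgeIntegral T W h a b ω ^ 2 ∂P ∈ Set.Icc ((b - a) ^ 3 / 12) ((b - a) ^ 3 / 3) := by
  rw [hW.integral_bridgeIntegral_sq hh ha hab hb]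
  set κ : ℝ → ℝ := fun t => (t - a) * (b - t) / 2 with hκ
  set m : ℝ → ℝ := fun t => ∫ r in a..b, h r * bridgeKernel a b t r with hm
  have hi : ∀ (c : ℝ) t, IntervalIntegrable (fun r => c * bridgeKernel a b t r) volume a b :=
    fun c t => Continuous.intervalIntegrable (by fun_prop) _ _
  have hi' : ∀ t, IntervalIntegrable (fun r => h r * bridgeKernel a b t r) volume a b :=
    fun t => Continuous.intervalIntegrable (by fun_prop) _ _
  -- Another factor `h t` between `-2` and `-1` puts `h t * m t` between `κ t` and `4 * κ t`, and
  -- `κ` integrates to `(b - a)³ / 12`.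
  have hmle : ∀ t ∈ Set.Icc a b, m t ∈ Set.Icc (-2 * κ t) (-κ t) := by
    intro t ht
    have hK := integral_bridgeKernel hab ht
    constructor
    · have := intervalIntegral.integral_mono_on hab.le (hi (-2) t) (hi' t) fun r hr =>
        mul_le_mul_of_nonneg_right (hbd r hr).1 (bridgeKernel_nonneg hab ht hr)
      rwa [intervalIntegral.integral_const_mul, hK] at this
    · have := intervalIntegral.integral_mono_on hab.le (hi' t) (hi (-1) t) fun r hr =>
        mul_le_mul_of_nonneg_right (hbd r hr).2 (bridgeKernel_nonneg hab ht hr)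
      rwa [intervalIntegral.integral_const_mul, hK, neg_one_mul] at this
  have hmc : Continuous m := by
    refine intervalIntegral.continuous_parametric_intervalIntegral_of_continuous' ?_ a b
    simp only [Function.uncurry_def, bridgeKernel]
    fun_prop
  have hκ0 : ∀ t ∈ Set.Icc a b, 0 ≤ κ t := fun t ht => by
    have := mul_nonneg (sub_nonneg.2 ht.1) (sub_nonneg.2 ht.2)
    simp only [hκ]
    positivity
  have hκi : ∀ c : ℝ, IntervalIntegrable (fun t => c * κ t) volume a b := fun c =>
    Continuous.intervalIntegrable (by fun_prop) _ _
  have hmi : IntervalIntegrable (fun t => h t * m t) volume a b :=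
    Continuous.intervalIntegrable (by fun_prop) _ _
  have hκint : ∫ t in a..b, κ t = (b - a) ^ 3 / 12 := integral_sub_mul_sub_half a b
  constructor
  · have := intervalIntegral.integral_mono_on hab.le (hκi 1) hmi fun t ht => by
      have h1 := hbd t ht
      have h2 := hmle t ht
      have h3 := hκ0 t ht
      nlinarith [h1.2, h2.2]
    rwa [intervalIntegral.integral_const_mul, hκint, one_mul] at this
  · have := intervalIntegral.integral_mono_on hab.le hmi (hκi 4) fun t ht => by
      have h1 := hbd t ht
      have h2 := hmle t ht
      have h3 := hκ0 t ht
      nlinarith [h1.1, h1.2, h2.1, h2.2]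
    rw [intervalIntegral.integral_const_mul, hκint] at this
    linarith

/-- All variables lie in the span of one Gaussian process, so vanishing covariance with each
observed value gives independence from the whole observed family. -/
theorem indepFun_bridgeIntegral (hW : IsStandardBrownianMotion P 𝔽 W)
    (hh : Continuous h) (ha : 0 ≤ a) (hab : a < b) (hb : b ≤ T) :
    IndepFun (fun ω (s : observedTimes a b T) => W s ω) (bridgeIntegral T W h a b) P := by
  have hT : 0 ≤ T := ha.trans (hab.le.trans hb)
  have hsub := observedTimes_subset (T := T) (ha.trans hab.le) (hab.le.trans hb)
  have hWc : ∀ s : observedTimes a b T, W s = clampedPath T W s := fun s =>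
    (clampedPath_of_mem (hsub s.2)).symm
  have hind : IndepFun (fun ω (s : observedTimes a b T) => W s ω)
      (fun ω (_ : Unit) => bridgeIntegral T W h a b ω) P := by
    refine IsGaussianProcess.indepFun_of_covariance_eq_zero
      (X := fun s : observedTimes a b T => W s) (Y := fun _ : Unit => bridgeIntegral T W h a b)
      (isGaussianProcess_of_mem_span (hW.isGaussianProcess_pathFunctional hT) ?_)
      (fun s => (hW.measurable ⟨s, hsub s.2⟩).aemeasurable)
      (fun _ => (hW.measurable_bridgeIntegral hT hh hab.le).aemeasurable) fun s _ => ?_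
    · rintro (s | _)
      · exact Submodule.subset_span ⟨Sum.inl s, (hWc s).symm⟩
      · exact bridgeIntegral_mem_span hh T W a b
    · rw [hWc s, covariance_eq_sub (hW.memLp_clamped hT s) (hW.memLp_bridgeIntegral hT hh a b),
        hW.integral_clamped hT, zero_mul, sub_zero]
      exact hW.integral_clamped_mul_bridgeIntegral_eq_zero hh ha hab hb s.2
  exact hind.comp measurable_id (measurable_pi_apply ())

/-- The subtraction cancels the path integral over the gap, leaving integrals over `[0,a]` and
`[b,T]` and multiples of `W a` and `W b`. -/
theorem measurable_sub_bridgeIntegral (hW : IsStandardBrownianMotion P 𝔽 W)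
    (hh : Continuous h) (ha : 0 ≤ a) (hab : a < b) (hb : b ≤ T) :
    Measurable[MeasurableSpace.comap (fun ω (s : observedTimes a b T) => W s ω) inferInstance]
      (fun ω => weightedPathIntegral T W h 0 T ω - bridgeIntegral T W h a b ω) := by
  have hT : 0 ≤ T := ha.trans (hab.le.trans hb)
  have hsub := observedTimes_subset (T := T) (ha.trans hab.le) (hab.le.trans hb)
  have hc := hW.continuous_clamped hT
  have hmB : ∀ s ∈ observedTimes a b T, Measurable[MeasurableSpace.comap
      (fun ω (s : observedTimes a b T) => W s ω) inferInstance] (clampedPath T W s) := by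
    intro s hs
    rw [clampedPath_of_mem (hsub hs)]
    exact (measurable_pi_apply (X := fun _ : observedTimes a b T => ℝ) ⟨s, hs⟩).comp
      (comap_measurable _)
  have e : (fun ω => weightedPathIntegral T W h 0 T ω - bridgeIntegral T W h a b ω)
      = fun ω => weightedPathIntegral T W h 0 a ω + weightedPathIntegral T W h b T ω
        + (∫ r in a..b, h r * ((b - r) / (b - a))) * clampedPath T W a ω
        + (∫ r in a..b, h r * ((r - a) / (b - a))) * clampedPath T W b ω := by
    funext ω
    have hi : ∀ p q, IntervalIntegrable (fun s => h s * clampedPath T W s ω) volume p q :=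
      fun p q => (hh.mul (hc ω)).intervalIntegrable _ _
    unfold bridgeIntegral weightedPathIntegral
    rw [← intervalIntegral.integral_add_adjacent_intervals (hi 0 a) (hi a T),
      ← intervalIntegral.integral_add_adjacent_intervals (hi a b) (hi b T)]
    ring
  rw [e]
  have m1 := measurable_weightedPathIntegral hc hh ha fun s hs => hmB s (Or.inl hs)
  have m2 := measurable_weightedPathIntegral hc hh hb fun s hs => hmB s (Or.inr hs)
  exact ((m1.add m2).add ((hmB a (Or.inl ⟨ha, le_rfl⟩)).const_mul _)).add
    ((hmB b (Or.inr ⟨le_rfl, hb⟩)).const_mul _)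

theorem hasGaussianLaw_sub_bridgeIntegral (hW : IsStandardBrownianMotion P 𝔽 W) (hT : 0 ≤ T)
    (hh : Continuous h) :
    HasGaussianLaw (fun ω => weightedPathIntegral T W h 0 T ω - bridgeIntegral T W h a b ω) P :=
  hW.hasGaussianLaw_of_mem_span hT (Submodule.sub_mem _
    (Submodule.subset_span ⟨Sum.inr (0, T, ⟨h, hh⟩), rfl⟩) (bridgeIntegral_mem_span hh T W a b))

theorem hasLaw_gaussianReal_of_integral_eq_zero {Y : Ω → ℝ} (hY : HasGaussianLaw Y P)
    (h0 : ∫ ω, Y ω ∂P = 0) : HasLaw Y (gaussianReal 0 (∫ ω, Y ω ^ 2 ∂P).toNNReal) P := by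
  refine ⟨hY.aemeasurable, ?_⟩
  rw [hY.map_eq_gaussianReal, h0, variance_eq_integral hY.aemeasurable, h0]
  simp

/-- The Wiener integral of `f` is the sum of a functional of the observed path and an independent
centred Gaussian variable. -/
theorem exists_wienerIntegral_eq_add (hW : IsStandardBrownianMotion P 𝔽 W) {f : ℝ → ℝ}
    (hf : ContDiff ℝ (⊤ : ℕ∞) f) (hfT : f T = 0) (ha : 0 ≤ a) (hab : a < b) (hb : b ≤ T)
    (hbd : ∀ s ∈ Set.Icc a b, deriv f s ∈ Set.Icc (-2) (-1)) :
    ∃ (Y Z : Ω → ℝ) (v w : ℝ),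
      (∀ ω, -weightedPathIntegral T W (deriv f) 0 T ω = Y ω + Z ω) ∧
      Measurable[MeasurableSpace.comap (fun ω (s : observedTimes a b T) => W s ω) inferInstance] Y ∧
      Measurable Z ∧ IndepFun (fun ω (s : observedTimes a b T) => W s ω) Z P ∧
      HasLaw Y (gaussianReal 0 w.toNNReal) P ∧ HasLaw Z (gaussianReal 0 v.toNNReal) P ∧
      v ∈ Set.Icc ((b - a) ^ 3 / 12) ((b - a) ^ 3 / 3) ∧
      w + v = ∫ s in (0 : ℝ)..T, f s ^ 2 := by
  have hT : 0 ≤ T := ha.trans (hab.le.trans hb)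
  have hh : Continuous (deriv f) := hf.continuous_deriv (by simp)
  set V := bridgeIntegral T W (deriv f) a b with hV
  set X := weightedPathIntegral T W (deriv f) 0 T with hX
  have hYm := hW.measurable_sub_bridgeIntegral hh ha hab hb
  have hind := hW.indepFun_bridgeIntegral hh ha hab hb
  have hRg : HasGaussianLaw (fun ω => X ω - V ω) P := hW.hasGaussianLaw_sub_bridgeIntegral hT hh
  have hVg : HasGaussianLaw V P :=
    hW.hasGaussianLaw_of_mem_span hT (bridgeIntegral_mem_span hh T W a b)
  have hXL : MemLp X 2 P := hW.memLp_weightedPathIntegral hT hh 0 T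
  have hVL : MemLp V 2 P := hW.memLp_bridgeIntegral hT hh a b
  have hX0 : ∫ ω, X ω ∂P = 0 := hW.integral_weightedPathIntegral hT hh hT
  have hV0 : ∫ ω, V ω ∂P = 0 := hW.integral_bridgeIntegral hT hh hab.le
  have hR0 : ∫ ω, (X ω - V ω) ∂P = 0 := by
    rw [integral_sub (hXL.integrable (by norm_num)) (hVL.integrable (by norm_num)), hX0, hV0,
      sub_zero]
  have hRL : MemLp (fun ω => X ω - V ω) 2 P := hXL.sub hVL
  have hRV : IndepFun (fun ω => X ω - V ω) V P :=
    indep_of_indep_of_le_left hind hYm.comap_le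
  have hcross : ∫ ω, (X ω - V ω) * V ω ∂P = 0 := by
    rw [hRV.integral_fun_mul_eq_mul_integral hRL.1 hVL.1, hR0, zero_mul]
  have hneg : ∀ {U : Ω → ℝ} {c : ℝ}, HasLaw U (gaussianReal 0 c.toNNReal) P →
      HasLaw (fun ω => -U ω) (gaussianReal 0 c.toNNReal) P := fun hU => by
    have := gaussianReal_neg hU
    rwa [neg_zero] at this
  -- `Z` is the negative of the bridge integral and `Y` that of the remainder; the variances add
  -- because the two are independent and centred.
  refine ⟨fun ω => -(X ω - V ω), fun ω => -V ω, ∫ ω, V ω ^ 2 ∂P, ∫ ω, (X ω - V ω) ^ 2 ∂P,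
    fun ω => by ring, hYm.neg, (hW.measurable_bridgeIntegral hT hh hab.le).neg,
    hind.comp measurable_id measurable_neg,
    hneg (hasLaw_gaussianReal_of_integral_eq_zero hRg hR0),
    hneg (hasLaw_gaussianReal_of_integral_eq_zero hVg hV0),
    hW.integral_bridgeIntegral_sq_mem hh ha hab hb hbd, ?_⟩
  rw [← hW.integral_wienerIntegral_sq hT hf hfT, ← hX]
  have e : ∀ ω, X ω ^ 2 = ((X ω - V ω) ^ 2 + V ω ^ 2) + 2 * ((X ω - V ω) * V ω) := by
    intro ω; ring
  have i1 : Integrable (fun ω => (X ω - V ω) ^ 2) P := hRL.integrable_sq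
  have i2 : Integrable (fun ω => V ω ^ 2) P := hVL.integrable_sq
  have i3 : Integrable (fun ω => (X ω - V ω) * V ω) P := hRL.integrable_mul hVL
  simp_rw [e]
  refine Eq.symm ((integral_add (i1.add i2) (i3.const_mul 2)).trans ?_)
  rw [integral_add' i1 i2, integral_const_mul, hcross]
  ring

end IsStandardBrownianMotion

/-! ### Oscillating integrals with a decreasing weight. -/

section SineIntegrals

theorem one_le_abs_sin_add_abs_cos (x : ℝ) : 1 ≤ |Real.sin x| + |Real.cos x| := by
  nlinarith [Real.sin_sq_add_cos_sq x, sq_abs (Real.sin x), sq_abs (Real.cos x),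
    abs_nonneg (Real.sin x), abs_nonneg (Real.cos x),
    mul_nonneg (abs_nonneg (Real.sin x)) (abs_nonneg (Real.cos x))]

/-- The range is that of `k (x - 1/8)` for `k ∈ [1, π]` and `x ∈ [1/2, 1]`. At the right end,
Jordan's inequality gives exactly `1/4`. -/
theorem one_fourth_le_sin {x : ℝ} (h1 : 3 / 8 ≤ x) (h2 : x ≤ 7 * Real.pi / 8) :
    1 / 4 ≤ Real.sin x := by
  have hpi := Real.pi_gt_three
  rcases le_total x (Real.pi / 2) with h | h
  · have h3 : Real.sin (3 / 8) ≤ Real.sin x :=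
      Real.sin_le_sin_of_le_of_le_pi_div_two (by linarith) h h1
    have h4 := Real.sin_gt_sub_cube (x := 3 / 8) (by norm_num)
    norm_num at h4 h3 ⊢
    linarith
  · rw [← Real.sin_pi_sub]
    have h5 := Real.mul_le_sin (x := Real.pi - x) (by linarith) (by linarith)
    refine le_trans ?_ h5
    rw [div_mul_eq_mul_div, le_div_iff₀ Real.pi_pos]
    linarith

/-- Shifting to the left increases the weight. For `k ≥ π` a shift by a quarter period, at most
`1/2`, turns the sine into a cosine, and `|sin| + |cos| ≥ 1`. For `k ≤ π` a shift by `1/8` already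
moves the argument to where the sine is at least `1/4`. -/
theorem integral_le_four_mul_integral_abs_sin_mul {w : ℝ → ℝ} (hw : Continuous w)
    (hw0 : ∀ x, 0 ≤ w x) (hwa : AntitoneOn w (Set.Ici 0)) {k : ℝ} (hk : 1 ≤ k) :
    1 / 4 * ∫ x in (1 / 2 : ℝ)..1, w x ≤ ∫ x in (0 : ℝ)..1, |Real.sin (k * x)| * w x := by
  set F : ℝ → ℝ := fun x => |Real.sin (k * x)| * w x with hF
  have hFc : Continuous F := by fun_prop
  have hF0 : ∀ x, 0 ≤ F x := fun x => mul_nonneg (abs_nonneg _) (hw0 x)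
  have hsub : ∀ p q, 0 ≤ p → p ≤ q → q ≤ 1 → ∫ x in p..q, F x ≤ ∫ x in (0 : ℝ)..1, F x :=
    fun p q h1 h2 h3 => intervalIntegral.integral_mono_interval h1 h2 h3
      (ae_of_all _ hF0) (hFc.intervalIntegrable _ _)
  have hshift : ∀ h : ℝ, 0 ≤ h → h ≤ 1 / 2 →
      ∫ x in (1 / 2 : ℝ)..1, F (x - h) ≤ ∫ x in (0 : ℝ)..1, F x := by
    intro h h1 h2
    rw [intervalIntegral.integral_comp_sub_right]
    exact hsub _ _ (by linarith) (by linarith) (by linarith)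
  rcases le_total Real.pi k with hkpi | hkpi
  · have hk0 : 0 < k := by linarith
    set h := Real.pi / (2 * k) with hh
    have hh0 : 0 ≤ h := by have := Real.pi_pos; positivity
    have hh2 : h ≤ 1 / 2 := by
      rw [hh, div_le_iff₀ (by positivity)]
      linarith
    have hkh : k * h = Real.pi / 2 := by rw [hh]; field_simp
    have hpt : ∀ x ∈ Set.Icc (1 / 2 : ℝ) 1, w x ≤ F x + F (x - h) := by
      intro x hx
      have h1 : |Real.sin (k * (x - h))| = |Real.cos (k * x)| := by
        rw [mul_sub, hkh, Real.sin_sub_pi_div_two, abs_neg]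
      have h2 : w x ≤ w (x - h) :=
        hwa (Set.mem_Ici.2 (by linarith [hx.1])) (Set.mem_Ici.2 (by linarith [hx.1]))
          (by linarith)
      simp only [hF]
      rw [h1]
      have h3 := one_le_abs_sin_add_abs_cos (k * x)
      nlinarith [hw0 x, mul_le_mul_of_nonneg_left h2 (abs_nonneg (Real.cos (k * x)))]
    have hint := intervalIntegral.integral_mono_on (by norm_num : (1 / 2 : ℝ) ≤ 1)
      (hw.intervalIntegrable (μ := volume) _ _)
      (Continuous.intervalIntegrable (by fun_prop) _ _) hpt
    rw [intervalIntegral.integral_add (hFc.intervalIntegrable _ _)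
      (Continuous.intervalIntegrable (by fun_prop) _ _)] at hint
    have h1 := hsub (1 / 2) 1 (by norm_num) (by norm_num) le_rfl
    have h2 := hshift h hh0 hh2
    have h3 : 0 ≤ ∫ x in (0 : ℝ)..1, F x :=
      intervalIntegral.integral_nonneg (by norm_num) fun x _ => hF0 x
    linarith
  · have hpt : ∀ x ∈ Set.Icc (1 / 2 : ℝ) 1, 1 / 4 * w x ≤ F (x - 1 / 8) := by
      intro x hx
      have h2 : w x ≤ w (x - 1 / 8) :=
        hwa (Set.mem_Ici.2 (by linarith [hx.1])) (Set.mem_Ici.2 (by linarith [hx.1]))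
          (by linarith)
      have h3 : 1 / 4 ≤ Real.sin (k * (x - 1 / 8)) := by
        refine one_fourth_le_sin ?_ ?_
        · nlinarith [hx.1]
        · nlinarith [hx.2, hx.1, Real.pi_pos]
      exact mul_le_mul (h3.trans (le_abs_self _)) h2 (hw0 _) (abs_nonneg _)
    have hint := intervalIntegral.integral_mono_on (by norm_num : (1 / 2 : ℝ) ≤ 1)
      (Continuous.intervalIntegrable (μ := volume) (by fun_prop) _ _)
      (Continuous.intervalIntegrable (μ := volume) (by fun_prop) _ _) hpt
    rw [intervalIntegral.integral_const_mul] at hint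
    exact hint.trans (hshift (1 / 8) (by norm_num) (by norm_num))

end SineIntegrals

/-! ### Lower bounds for the two Gaussian expectations. -/

section GaussianEstimates

theorem setLIntegral_gaussianReal {v : NNReal} (hv : v ≠ 0) {φ : ℝ → ℝ} (hφ : Continuous φ)
    (hφ0 : ∀ x, 0 ≤ φ x) {p q : ℝ} (hpq : p ≤ q) :
    ∫⁻ x in Set.Icc p q, ENNReal.ofReal (φ x) ∂(gaussianReal 0 v)
      = ENNReal.ofReal ((√(2 * Real.pi * v))⁻¹ *
        ∫ x in p..q, φ x * Real.exp (-x ^ 2 / (2 * v))) := by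
  have hφm : Measurable fun x => ENNReal.ofReal (φ x) := hφ.measurable.ennreal_ofReal
  rw [gaussianReal_of_var_ne_zero 0 hv, restrict_withDensity measurableSet_Icc,
    lintegral_withDensity_eq_lintegral_mul _ (measurable_gaussianPDF 0 v) hφm,
    ← intervalIntegral.integral_const_mul, intervalIntegral.integral_of_le hpq,
    ← integral_Icc_eq_integral_Ioc, ofReal_integral_eq_lintegral_ofReal]
  · refine lintegral_congr fun x => ?_
    rw [Pi.mul_apply, gaussianPDF, ← ENNReal.ofReal_mul (gaussianPDFReal_nonneg 0 v x),
      gaussianPDFReal, sub_zero]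
    congr 1
    ring
  · exact Continuous.integrableOn_Icc (by fun_prop)
  · refine ae_of_all _ fun x => ?_
    have := hφ0 x
    simp only [Pi.zero_apply]
    positivity

/-- The upper bound on `w` controls the normalising constant and the lower bound the exponent. Only
the half `[c, c+1]` is kept: there the Gaussian weight decreases, as the sine estimate requires. -/
theorem le_setLIntegral_abs_sin_mul_sub {c k w α : ℝ} (hc : 0 ≤ c) (hk : 1 ≤ k) (hα : 0 < α)
    (hw : w ∈ Set.Icc (α / 2) α) :
    ENNReal.ofReal ((√(2 * Real.pi * α))⁻¹ *
        (1 / 4 * ∫ x in (c + 1 / 2)..(c + 1), Real.exp (-x ^ 2 / α)))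
      ≤ ∫⁻ y in Set.Icc (c - 1) (c + 1), ENNReal.ofReal |Real.sin (k * (y - c))|
        ∂(gaussianReal 0 w.toNNReal) := by
  have hw0 : 0 < w := lt_of_lt_of_le (by linarith) hw.1
  rw [setLIntegral_gaussianReal (φ := fun y => |Real.sin (k * (y - c))|)
    (by simpa using hw0) (by fun_prop) (fun _ => abs_nonneg _) (by linarith),
    Real.coe_toNNReal _ hw0.le]
  refine ENNReal.ofReal_le_ofReal ?_
  have hpi := Real.pi_pos
  have h1 : (√(2 * Real.pi * α))⁻¹ ≤ (√(2 * Real.pi * w))⁻¹ := by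
    have := hw.2
    gcongr
  have h2 : 1 / 4 * ∫ x in (c + 1 / 2)..(c + 1), Real.exp (-x ^ 2 / α)
      ≤ ∫ y in (c - 1)..(c + 1), |Real.sin (k * (y - c))| * Real.exp (-y ^ 2 / (2 * w)) := by
    have e1 := integral_le_four_mul_integral_abs_sin_mul
      (w := fun x => Real.exp (-(x + c) ^ 2 / α)) (by fun_prop) (fun _ => (Real.exp_pos _).le)
      (fun x hx y hy hxy => Real.exp_le_exp.2 (by
        have : (x + c) ^ 2 ≤ (y + c) ^ 2 := by
          have := Set.mem_Ici.1 hx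
          gcongr
        gcongr)) hk
    have e2 : ∫ x in (1 / 2 : ℝ)..1, Real.exp (-(x + c) ^ 2 / α)
        = ∫ x in (c + 1 / 2)..(c + 1), Real.exp (-x ^ 2 / α) := by
      rw [intervalIntegral.integral_comp_add_right (fun x => Real.exp (-x ^ 2 / α)), add_comm,
        add_comm 1]
    have e3 : ∫ x in (0 : ℝ)..1, |Real.sin (k * x)| * Real.exp (-(x + c) ^ 2 / α)
        = ∫ y in c..(c + 1), |Real.sin (k * (y - c))| * Real.exp (-y ^ 2 / α) := by
      have := intervalIntegral.integral_comp_add_right (a := 0) (b := 1)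
        (fun y => |Real.sin (k * (y - c))| * Real.exp (-y ^ 2 / α)) c
      simp only [add_sub_cancel_right] at this
      rw [this, zero_add, add_comm]
    rw [e2, e3] at e1
    refine e1.trans ?_
    have e4 : ∫ y in c..(c + 1), |Real.sin (k * (y - c))| * Real.exp (-y ^ 2 / α)
        ≤ ∫ y in c..(c + 1), |Real.sin (k * (y - c))| * Real.exp (-y ^ 2 / (2 * w)) := by
      refine intervalIntegral.integral_mono_on (by linarith)
        (Continuous.intervalIntegrable (by fun_prop) _ _)
        (Continuous.intervalIntegrable (by fun_prop) _ _) fun y _ => ?_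
      refine mul_le_mul_of_nonneg_left (Real.exp_le_exp.2 ?_) (abs_nonneg _)
      rw [neg_div, neg_div, neg_le_neg_iff]
      have := hw.1
      exact div_le_div_of_nonneg_left (sq_nonneg y) hα (by linarith)
    refine e4.trans (intervalIntegral.integral_mono_interval (by linarith) (by linarith) le_rfl
      (ae_of_all _ fun y => mul_nonneg (abs_nonneg _) (Real.exp_pos _).le)
      (Continuous.intervalIntegrable (by fun_prop) _ _))
  have h3 : 0 ≤ ∫ x in (c + 1 / 2)..(c + 1), Real.exp (-x ^ 2 / α) :=
    intervalIntegral.integral_nonneg (by linarith) fun x _ => (Real.exp_pos _).le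
  exact mul_le_mul h1 h2 (by positivity) (by positivity)

/-- Substituting `y = k z` rescales the variance to `v k²`, which lies between `T³/12` and `T³/3`:
the lower end enters the exponential, the upper end the normalisation. The factor two is the
symmetry in `z`, and `k ≥ 1` lets `[0,k]` shrink to `[0,1]`. -/
theorem le_setLIntegral_abs_sin_mul {d k v T : ℝ} (hd : 0 < d) (hdT : d ≤ T) (hk : 1 ≤ k)
    (hkd : k ^ 2 * d ^ 3 = T ^ 3) (hv : v ∈ Set.Icc (d ^ 3 / 12) (d ^ 3 / 3)) :
    ENNReal.ofReal (2 * (√(2 * Real.pi * (T ^ 3 / 3)))⁻¹ *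
        ∫ y in (0 : ℝ)..1, |Real.sin y| * Real.exp (-6 * y ^ 2 / T ^ 3))
      ≤ ∫⁻ z in Set.Icc (-1) 1, ENNReal.ofReal |Real.sin (k * z)|
        ∂(gaussianReal 0 v.toNNReal) := by
  have hT : 0 < T := hd.trans_le hdT
  have hk0 : 0 < k := by linarith
  have hv0 : 0 < v := lt_of_lt_of_le (by positivity) hv.1
  have hpi := Real.pi_pos
  rw [setLIntegral_gaussianReal (φ := fun z => |Real.sin (k * z)|)
    (by simpa using hv0) (by fun_prop) (fun _ => abs_nonneg _) (by norm_num),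
    Real.coe_toNNReal _ hv0.le]
  refine ENNReal.ofReal_le_ofReal ?_
  set F : ℝ → ℝ := fun z => |Real.sin (k * z)| * Real.exp (-z ^ 2 / (2 * v)) with hF
  have hFc : Continuous F := by fun_prop
  have hsymm : ∫ z in (-1 : ℝ)..1, F z = 2 * ∫ z in (0 : ℝ)..1, F z := by
    rw [← intervalIntegral.integral_add_adjacent_intervals (hFc.intervalIntegrable (-1) 0)
      (hFc.intervalIntegrable 0 1)]
    have h1 : ∫ z in (-1 : ℝ)..0, F z = ∫ z in (0 : ℝ)..1, F z := by
      have := intervalIntegral.integral_comp_neg (a := 0) (b := 1) F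
      rw [neg_zero] at this
      rw [← this]
      refine intervalIntegral.integral_congr fun z _ => ?_
      simp [hF]
    rw [h1]
    ring
  have hvk : v * k ^ 2 ∈ Set.Icc (T ^ 3 / 12) (T ^ 3 / 3) := by
    rw [← hkd]
    have h2 : 0 ≤ k ^ 2 := sq_nonneg k
    constructor
    · nlinarith [mul_le_mul_of_nonneg_right hv.1 h2]
    · nlinarith [mul_le_mul_of_nonneg_right hv.2 h2]
  have hvk0 : 0 < v * k ^ 2 := by positivity
  have hsubst : ∫ z in (0 : ℝ)..1, F z
      = k⁻¹ * ∫ y in (0 : ℝ)..k, |Real.sin y| * Real.exp (-y ^ 2 / (2 * (v * k ^ 2))) := by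
    have := intervalIntegral.integral_comp_mul_left (a := 0) (b := 1)
      (fun y => |Real.sin y| * Real.exp (-y ^ 2 / (2 * (v * k ^ 2)))) hk0.ne'
    rw [mul_zero, mul_one, smul_eq_mul] at this
    rw [← this]
    refine intervalIntegral.integral_congr fun z _ => ?_
    simp only [hF]
    congr 2
    field_simp
  have hI : ∫ y in (0 : ℝ)..1, |Real.sin y| * Real.exp (-6 * y ^ 2 / T ^ 3)
      ≤ ∫ y in (0 : ℝ)..k, |Real.sin y| * Real.exp (-y ^ 2 / (2 * (v * k ^ 2))) := by
    have h1 : ∫ y in (0 : ℝ)..1, |Real.sin y| * Real.exp (-6 * y ^ 2 / T ^ 3)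
        ≤ ∫ y in (0 : ℝ)..1, |Real.sin y| * Real.exp (-y ^ 2 / (2 * (v * k ^ 2))) := by
      refine intervalIntegral.integral_mono_on (by norm_num)
        (Continuous.intervalIntegrable (by fun_prop) _ _)
        (Continuous.intervalIntegrable (by fun_prop) _ _) fun y _ => ?_
      refine mul_le_mul_of_nonneg_left (Real.exp_le_exp.2 ?_) (abs_nonneg _)
      have h2 : y ^ 2 / (2 * (v * k ^ 2)) ≤ y ^ 2 / (T ^ 3 / 6) :=
        div_le_div_of_nonneg_left (sq_nonneg y) (by positivity) (by linarith [hvk.1])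
      have h3 : -6 * y ^ 2 / T ^ 3 = -(y ^ 2 / (T ^ 3 / 6)) := by field_simp
      rw [h3, neg_div]
      exact neg_le_neg h2
    exact h1.trans (intervalIntegral.integral_mono_interval le_rfl (by norm_num) hk
      (ae_of_all _ fun y => mul_nonneg (abs_nonneg _) (Real.exp_pos _).le)
      (Continuous.intervalIntegrable (by fun_prop) _ _))
  have hI0 : 0 ≤ ∫ y in (0 : ℝ)..1, |Real.sin y| * Real.exp (-6 * y ^ 2 / T ^ 3) :=
    intervalIntegral.integral_nonneg (by norm_num) fun y _ =>
      mul_nonneg (abs_nonneg _) (Real.exp_pos _).le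
  have hroot : (√(2 * Real.pi * (T ^ 3 / 3)))⁻¹ ≤ (√(2 * Real.pi * v))⁻¹ * k⁻¹ := by
    rw [← mul_inv]
    have h1 : √(2 * Real.pi * v) * k = √(2 * Real.pi * (v * k ^ 2)) := by
      rw [← mul_assoc (2 * Real.pi), Real.sqrt_mul (by positivity) (k ^ 2), Real.sqrt_sq hk0.le]
    rw [h1]
    have := hvk.2
    gcongr
  rw [hsymm, hsubst]
  calc 2 * (√(2 * Real.pi * (T ^ 3 / 3)))⁻¹ *
        ∫ y in (0 : ℝ)..1, |Real.sin y| * Real.exp (-6 * y ^ 2 / T ^ 3)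
      ≤ 2 * ((√(2 * Real.pi * v))⁻¹ * k⁻¹) *
        ∫ y in (0 : ℝ)..k, |Real.sin y| * Real.exp (-y ^ 2 / (2 * (v * k ^ 2))) := by
        gcongr
    _ = _ := by ring

end GaussianEstimates

/-! ### Reflection of the unobserved component. -/

section Reflection

/-- Triangle inequality through `u`; by symmetry of `μ` both halves have the same integral. -/
theorem lintegral_abs_sub_le_of_symm {μ : Measure ℝ} (hμ : μ.map Neg.neg = μ) {Γ : ℝ → ℝ}
    (hΓ : Measurable Γ) (y u : ℝ) :
    ∫⁻ z, ENNReal.ofReal |Γ (y + z) - Γ (y - z)| ∂μ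
      ≤ 2 * ∫⁻ z, ENNReal.ofReal |Γ (y + z) - u| ∂μ := by
  have hm : Measurable fun z => ENNReal.ofReal |Γ (y + z) - u| := by fun_prop
  have hsymm : ∫⁻ z, ENNReal.ofReal |Γ (y - z) - u| ∂μ
      = ∫⁻ z, ENNReal.ofReal |Γ (y + z) - u| ∂μ := by
    conv_rhs => rw [← hμ, lintegral_map hm measurable_neg]
    simp_rw [sub_eq_add_neg y]
  rw [two_mul]
  nth_rewrite 2 [← hsymm]
  rw [← lintegral_add_left hm]
  refine lintegral_mono fun z => ?_
  rw [← ENNReal.ofReal_add (abs_nonneg _) (abs_nonneg _)]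
  refine ENNReal.ofReal_le_ofReal ?_
  rw [abs_sub_comm (Γ (y - z)) u]
  exact abs_sub_le _ _ _

/-- Approximation of `Γ(Y + Z)` by functionals of an information which is independent of the
symmetric variable `Z`. -/
theorem mul_mul_le_lintegral_abs_sub {Ω : Type*} {m mΩ : MeasurableSpace Ω} {P : Measure Ω}
    [IsProbabilityMeasure P] (hm : m ≤ mΩ) {Y Z U : Ω → ℝ}
    (hY : Measurable[m] Y) (hU : Measurable[m] U) (hZ : Measurable Z)
    (hind : Indep m (MeasurableSpace.comap Z inferInstance) P) {Γ : ℝ → ℝ} (hΓ : Measurable Γ)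
    (hsymm : (P.map Z).map Neg.neg = P.map Z) {A B : Set ℝ} (hA : MeasurableSet A)
    (hB : MeasurableSet B) {p q : ℝ → ℝ} (hp : Measurable p) (hq : Measurable q)
    (hp0 : ∀ y, 0 ≤ p y) {C : ℝ} (hC : 0 ≤ C)
    (h : ∀ y ∈ A, ∀ z ∈ B, 2 * C * (p y * q z) ≤ |Γ (y + z) - Γ (y - z)|) :
    ENNReal.ofReal C * (∫⁻ y in A, ENNReal.ofReal (p y) ∂(P.map Y))
        * (∫⁻ z in B, ENNReal.ofReal (q z) ∂(P.map Z))
      ≤ ∫⁻ ω, ENNReal.ofReal |Γ (Y ω + Z ω) - U ω| ∂P := by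
  have hYU : Measurable[m] fun ω => (Y ω, U ω) := hY.prodMk hU
  have hYU' : Measurable fun ω => (Y ω, U ω) := hYU.mono hm le_rfl
  have hIF : IndepFun (fun ω => (Y ω, U ω)) Z P := indep_of_indep_of_le_left hind hYU.comap_le
  have hmap := (indepFun_iff_map_prod_eq_prod_map_map hYU'.aemeasurable hZ.aemeasurable).1 hIF
  have : IsProbabilityMeasure (P.map Z) := Measure.isProbabilityMeasure_map hZ.aemeasurable
  have hker : Measurable fun x : (ℝ × ℝ) × ℝ => ENNReal.ofReal |Γ (x.1.1 + x.2) - x.1.2| := by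
    fun_prop
  -- Independence freezes the pair `(Y, U)`, so that inside the `z`-integral the estimator is a
  -- constant.
  have hLHS : ∫⁻ ω, ENNReal.ofReal |Γ (Y ω + Z ω) - U ω| ∂P
      = ∫⁻ x, ∫⁻ z, ENNReal.ofReal |Γ (x.1 + z) - x.2| ∂(P.map Z)
        ∂(P.map fun ω => (Y ω, U ω)) := by
    rw [← lintegral_prod _ hker.aemeasurable, ← hmap, lintegral_map hker (hYU'.prodMk hZ)]
  set q' := ∫⁻ z in B, ENNReal.ofReal (q z) ∂(P.map Z) with hq'
  have hinner : ∀ x : ℝ × ℝ, A.indicator (fun y => ENNReal.ofReal C * ENNReal.ofReal (p y) * q') x.1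
      ≤ ∫⁻ z, ENNReal.ofReal |Γ (x.1 + z) - x.2| ∂(P.map Z) := by
    rintro ⟨y, u⟩
    by_cases hy : y ∈ A
    · rw [Set.indicator_of_mem hy]
      have h1 := lintegral_abs_sub_le_of_symm hsymm hΓ y u
      have h2 : 2 * (ENNReal.ofReal C * ENNReal.ofReal (p y) * q')
          ≤ ∫⁻ z, ENNReal.ofReal |Γ (y + z) - Γ (y - z)| ∂(P.map Z) := by
        rw [hq', ← mul_assoc, ← lintegral_const_mul _ hq.ennreal_ofReal]
        refine le_trans (setLIntegral_mono' hB fun z hz => ?_) (setLIntegral_le_lintegral B _)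
        rw [show (2 : ℝ≥0∞) = ENNReal.ofReal 2 by simp, ← ENNReal.ofReal_mul hC,
          ← ENNReal.ofReal_mul (by norm_num),
          ← ENNReal.ofReal_mul (mul_nonneg (by norm_num) (mul_nonneg hC (hp0 y)))]
        refine ENNReal.ofReal_le_ofReal (le_trans (le_of_eq ?_) (h y hy z hz))
        ring
      exact (ENNReal.mul_le_mul_iff_right (by norm_num) (by norm_num)).1 (h2.trans h1)
    · rw [Set.indicator_of_notMem hy]
      exact zero_le
  rw [hLHS]
  refine le_trans (le_of_eq ?_) (lintegral_mono hinner)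
  have hind' : Measurable (A.indicator fun y => ENNReal.ofReal C * ENNReal.ofReal (p y) * q') :=
    ((hp.ennreal_ofReal.const_mul _).mul_const _).indicator hA
  have hYmap : P.map Y = (P.map fun ω => (Y ω, U ω)).map Prod.fst := by
    rw [Measure.map_map measurable_fst hYU']
    rfl
  rw [← lintegral_map hind' measurable_fst, ← hYmap, lintegral_indicator hA,
    lintegral_mul_const _ (hp.ennreal_ofReal.const_mul _),
    lintegral_const_mul _ hp.ennreal_ofReal]

end Reflection

/-! ### Assembly of the lower bound. -/

theorem lemma3p12
    -- the deterministic data of the setting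
    (T τ τ₁ τ₂ α : ℝ) (hT : 0 < T) (hτ : τ ∈ Set.Ioo 0 T) (hτ₁ : τ₁ ∈ Set.Ioo τ T)
    (hτ₂ : τ₂ ∈ Set.Ioo τ₁ T) (hα : 2 * τ ^ 3 / 3 ≤ α)
    (f g : ℝ → ℝ) (hf : ContDiff ℝ (⊤ : ℕ∞) f) (hg : ContDiff ℝ (⊤ : ℕ∞) g)
    (hfg_bdd : BddAbove (Set.range fun x => |f x| + |g x|))
    (hf_pos : ∀ x, x < τ₁ → 0 < f x) (hf_zero : ∀ x, τ₁ ≤ x → f x = 0)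
    (hf' : ∀ x, deriv f x ∈ Set.Icc (-2) 0)
    (hf'τ : ∀ x ∈ Set.Ioo 0 τ, deriv f x ∈ Set.Ico (-2) (-1))
    (hg_zero : ∀ x, x ≤ τ₁ → g x = 0) (hg_four : ∀ x, τ₂ ≤ x → g x = 4)
    (hg' : ∀ x, 0 ≤ deriv g x)
    (hα_eq : α = ∫ s in (0 : ℝ)..τ₁, |f s| ^ 2)
    -- the probability space, the filtration and the Brownian motion
    {Ω : Type*} [mΩ : MeasurableSpace Ω] (P : Measure Ω) [IsProbabilityMeasure P]
    (𝔽 : Filtration (Set.Icc (0 : ℝ) T) mΩ) (h𝔽 : IsNormalFiltration P 𝔽)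
    (W : ℝ → Ω → ℝ) (hW : IsStandardBrownianMotion P 𝔽 W)
    -- the parameters of the lemma
    (a b c : ℝ) (ha : a ∈ Set.Ico 0 τ) (hb : b ∈ Set.Ioc a τ) (hc : 2 ≤ c)
    (ψ : ℝ → ℝ) (hψ : ContDiff ℝ (⊤ : ℕ∞) ψ)
    (hψ_eq : ∀ x ∈ Set.Icc (c - 2) (c + 2),
      ψ x = T ^ (3 / 2 : ℝ) / (b - a) ^ (3 / 2 : ℝ) * (x - c))
    -- the solution process associated with `ψ`
    (X₁ X₂ : ℝ → Ω → ℝ) (hX₁ : IsContinuousAdapted 𝔽 X₁) (hX₂ : IsContinuousAdapted 𝔽 X₂)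
    (hX₁_eq : ∀ t ∈ Set.Icc 0 T, IsItoIntegral P 𝔽 W (fun s ω => f (X₂ s ω)) t (X₁ t))
    (hX₂_eq : ∀ t ∈ Set.Icc 0 T, ∀ᵐ ω ∂P,
      X₂ t ω = t + ∫ s in (0 : ℝ)..t, g (X₂ s ω) * (Real.cos (ψ (X₁ s ω)) + 1))
    -- the approximation, Borel measurable for the topology of uniform convergence
    (u : C(observedTimes a b T, ℝ) → ℝ)
    (hu : Measurable[borel C(observedTimes a b T, ℝ)] u) :
    ENNReal.ofReal
        (√3 * (T - τ₂) / (Real.pi * √(T ^ 3 * α))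
          * (∫ x in (c + 1 / 2)..(c + 1), Real.exp (-x ^ 2 / α))
          * ∫ y in (0 : ℝ)..1, |Real.sin y| * Real.exp (-6 * y ^ 2 / T ^ 3))
      ≤ ∫⁻ ω, ENNReal.ofReal
          |X₂ T ω - u (restrictPath (fun s => W s ω) (hW.continuousOn ω)
            (observedTimes_subset (ha.1.trans hb.1.le) (ha.2.le.trans hτ.2.le)))| ∂P
    ∧ 0 < √3 * (T - τ₂) / (Real.pi * √(T ^ 3 * α))
          * (∫ x in (c + 1 / 2)..(c + 1), Real.exp (-x ^ 2 / α))
          * ∫ y in (0 : ℝ)..1, |Real.sin y| * Real.exp (-6 * y ^ 2 / T ^ 3) := by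
  have hT0 : 0 ≤ T := hT.le
  have hτ₁0 : 0 ≤ τ₁ := (hτ.1.trans hτ₁.1).le
  have hab : a < b := hb.1
  have hbT : b ≤ T := hb.2.trans hτ.2.le
  have hd : 0 < b - a := sub_pos.2 hab
  have hα0 : 0 < α := lt_of_lt_of_le (by have := hτ.1; positivity) hα
  have hTτ₂ : 0 < T - τ₂ := sub_pos.2 hτ₂.2
  have hg0 : ∀ y, 0 ≤ g y := fun y => by
    rw [← hg_zero (min y τ₁) (min_le_right _ _)]
    exact monotone_of_deriv_nonneg (hg.differentiable (by simp)) hg' (min_le_left _ _)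
  have hfT : f T = 0 := hf_zero T (hτ₁.2.le)
  have hfc : Continuous (deriv f) := hf.continuous_deriv (by simp)
  -- The bound by `-1` is given on the open interval only; continuity of the derivative extends it
  -- to the endpoints, since `a = 0` and `b = τ` are allowed.
  have hbd : ∀ s ∈ Set.Icc a b, deriv f s ∈ Set.Icc (-2) (-1) := by
    intro s hs
    refine ⟨(hf' s).1, ?_⟩
    have hcl : IsClosed {s | deriv f s ≤ -1} := isClosed_le hfc continuous_const
    have hsub : Set.Ioo 0 τ ⊆ {s | deriv f s ≤ -1} := fun r hr => (hf'τ r hr).2.le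
    have := hcl.closure_subset_iff.2 hsub
    rw [closure_Ioo hτ.1.ne] at this
    exact this ⟨ha.1.trans hs.1, hs.2.trans hb.2⟩
  obtain ⟨Y, Z, v, w, hX, hY, hZ, hind, hYlaw, hZlaw, hv, hwv⟩ :=
    hW.exists_wienerIntegral_eq_add hf hfT ha.1 hab hbT hbd
  have hα_T : ∫ s in (0 : ℝ)..T, f s ^ 2 = α := by
    have hi : ∀ p q, IntervalIntegrable (fun s => f s ^ 2) volume p q := fun p q =>
      (hf.continuous.pow 2).intervalIntegrable _ _
    have h0 : ∫ s in τ₁..T, f s ^ 2 = ∫ s in τ₁..T, (0 : ℝ) := by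
      refine intervalIntegral.integral_congr fun s hs => ?_
      rw [Set.uIcc_of_le hτ₁.2.le] at hs
      simp [hf_zero s hs.1]
    rw [hα_eq, ← intervalIntegral.integral_add_adjacent_intervals (hi 0 τ₁) (hi τ₁ T), h0]
    simp
  -- `v ≤ (b - a)³ / 3 ≤ τ³ / 3 ≤ α / 2` by the assumption on `α`.
  have hw : w ∈ Set.Icc (α / 2) α := by
    have h1 : (b - a) ^ 3 ≤ τ ^ 3 := pow_le_pow_left₀ hd.le (by linarith [hb.2, ha.1]) 3
    have h2 : 0 < (b - a) ^ 3 := by positivity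
    constructor <;> linarith [hv.1, hv.2]
  set k : ℝ := T ^ (3 / 2 : ℝ) / (b - a) ^ (3 / 2 : ℝ) with hk
  have hsq : ∀ {x : ℝ}, 0 < x → (x ^ (3 / 2 : ℝ)) ^ 2 = x ^ 3 := fun hx => by
    rw [← Real.rpow_natCast, ← Real.rpow_mul hx.le]
    norm_num
  have hdT : b - a ≤ T := by linarith [ha.1]
  have hk1 : 1 ≤ k := by
    rw [hk, one_le_div (by positivity)]
    exact Real.rpow_le_rpow hd.le hdT (by norm_num)
  have hkd : k ^ 2 * (b - a) ^ 3 = T ^ 3 := by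
    rw [hk, div_pow, hsq hT, hsq hd]
    field_simp
  set Γ : ℝ → ℝ := fun y => terminalValue g τ₁ τ₂ T (Real.cos (ψ y) + 1) with hΓ
  have hψc : Continuous ψ := hψ.continuous
  have hΓm : Measurable Γ :=
    (measurable_terminalValue hg.continuous hg0 hτ₂.1.le).comp
      (Continuous.measurable (by fun_prop))
  have hcos : ∀ y, 0 ≤ Real.cos (ψ y) + 1 := fun y => by linarith [Real.neg_one_le_cos (ψ y)]
  -- Both `y + z` and `y - z` stay within distance `2` of `c`, where `ψ` is affine, and the
  -- sum-to-product formula separates `y` from `z`.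
  have hosc : ∀ y ∈ Set.Icc (c - 1) (c + 1), ∀ z ∈ Set.Icc (-1 : ℝ) 1,
      2 * (4 * (T - τ₂)) * (|Real.sin (k * (y - c))| * |Real.sin (k * z)|)
        ≤ |Γ (y + z) - Γ (y - z)| := by
    intro y hy z hz
    have h1 := le_abs_terminalValue_sub (T := T) hg.continuous hg0 hτ₂.1.le (hcos (y + z))
      (hcos (y - z))
    refine le_trans (le_of_eq ?_) h1
    rw [add_sub_add_right_eq_sub, hψ_eq (y + z) ⟨by linarith [hy.1, hz.1], by linarith [hy.2, hz.2]⟩,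
      hψ_eq (y - z) ⟨by linarith [hy.1, hz.2], by linarith [hy.2, hz.1]⟩, Real.cos_sub_cos]
    have e1 : (k * (y + z - c) + k * (y - z - c)) / 2 = k * (y - c) := by ring
    have e2 : (k * (y + z - c) - k * (y - z - c)) / 2 = k * z := by ring
    rw [e1, e2, abs_mul, abs_mul, abs_neg, abs_two]
    ring
  have hKT := observedTimes_subset (ha.1.trans hb.1.le) (ha.2.le.trans hτ.2.le)
  have hKc : CompactSpace (observedTimes a b T) :=
    isCompact_iff_compactSpace.1 (isCompact_Icc.union isCompact_Icc)
  have hmle : MeasurableSpace.comap (fun ω (s : observedTimes a b T) => W s ω) inferInstance ≤ mΩ :=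
    (measurable_pi_lambda _ fun s : observedTimes a b T => hW.measurable ⟨s, hKT s.2⟩).comap_le
  have hUm : Measurable[MeasurableSpace.comap (fun ω (s : observedTimes a b T) => W s ω) inferInstance]
      fun ω =>
      u (restrictPath (fun s => W s ω) (hW.continuousOn ω) hKT) := by
    refine hu.comp (ContinuousMap.measurable_borel_of_eval fun s => ?_)
    exact (measurable_pi_apply (X := fun _ : observedTimes a b T => ℝ) s).comp
      (comap_measurable _)
  have hsymm : (P.map Z).map Neg.neg = P.map Z := by
    rw [hZlaw.map_eq]
    exact gaussianReal_map_neg.trans (by rw [neg_zero])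
  have key := mul_mul_le_lintegral_abs_sub hmle hY hUm hZ hind hΓm hsymm
    measurableSet_Icc measurableSet_Icc (Continuous.measurable (by fun_prop))
    (Continuous.measurable (by fun_prop)) (fun y => abs_nonneg _)
    (by linarith : 0 ≤ 4 * (T - τ₂)) hosc
  rw [hYlaw.map_eq, hZlaw.map_eq] at key
  have hEY := le_setLIntegral_abs_sin_mul_sub (c := c) (by linarith) hk1 hα0 hw
  have hEZ := le_setLIntegral_abs_sin_mul hd hdT hk1 hkd hv
  set I₁ := ∫ x in (c + 1 / 2)..(c + 1), Real.exp (-x ^ 2 / α) with hI₁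
  set I₂ := ∫ y in (0 : ℝ)..1, |Real.sin y| * Real.exp (-6 * y ^ 2 / T ^ 3) with hI₂
  have hpi := Real.pi_pos
  have hI₁0 : 0 < I₁ :=
    intervalIntegral.intervalIntegral_pos_of_pos
      (Continuous.intervalIntegrable (by fun_prop) _ _) (fun x => Real.exp_pos _) (by linarith)
  have hI₂0 : 0 < I₂ := by
    refine intervalIntegral.intervalIntegral_pos_of_pos_on
      (Continuous.intervalIntegrable (by fun_prop) _ _) (fun y hy => ?_) (by norm_num)
    have := Real.sin_pos_of_pos_of_lt_pi hy.1 (by linarith [hy.2, Real.pi_gt_three])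
    positivity
  refine ⟨?_, by positivity⟩
  have hfinal := ae_terminal_eq hT0 hτ₁0 hτ₁.2.le hτ₂.2.le hf hf_zero hg.continuous hg0 hg_zero
    hg_four hW hψc hX₁ hX₂ hX₁_eq hX₂_eq
  have hae : ∫⁻ ω, ENNReal.ofReal
        |X₂ T ω - u (restrictPath (fun s => W s ω) (hW.continuousOn ω) hKT)| ∂P
      = ∫⁻ ω, ENNReal.ofReal
        |Γ (Y ω + Z ω) - u (restrictPath (fun s => W s ω) (hW.continuousOn ω) hKT)| ∂P := by
    refine lintegral_congr_ae ?_
    filter_upwards [hfinal] with ω hω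
    rw [hω, hX ω]
  rw [hae]
  refine le_trans ?_ key
  have hconst : √3 * (T - τ₂) / (Real.pi * √(T ^ 3 * α)) * I₁ * I₂
      = 4 * (T - τ₂) * ((√(2 * Real.pi * α))⁻¹ * (1 / 4 * I₁))
        * (2 * (√(2 * Real.pi * (T ^ 3 / 3)))⁻¹ * I₂) := by
    have h1 : √(2 * Real.pi * α) * √(2 * Real.pi * (T ^ 3 / 3))
        = 2 * Real.pi * √(T ^ 3 * α) / √3 := by
      rw [← Real.sqrt_mul (by positivity), show 2 * Real.pi * α * (2 * Real.pi * (T ^ 3 / 3))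
        = (2 * Real.pi) ^ 2 * (T ^ 3 * α) / 3 by ring, Real.sqrt_div (by positivity),
        Real.sqrt_mul (by positivity), Real.sqrt_sq (by positivity)]
    calc √3 * (T - τ₂) / (Real.pi * √(T ^ 3 * α)) * I₁ * I₂
        = 2 * (T - τ₂) * (2 * Real.pi * √(T ^ 3 * α) / √3)⁻¹ * I₁ * I₂ := by
          have : √3 ≠ 0 := by positivity
          field_simp
      _ = _ := by
          rw [← h1, mul_inv]
          ring
  rw [hconst, ENNReal.ofReal_mul (by positivity), ENNReal.ofReal_mul (by positivity)]
  gcongr
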